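/- Let $n\ge 1$, $m\ge 0$ be integers and let $K:\mathbb R^n\to\mathbb R$. For a test function $\eta\in C_c^\infty(\mathbb R^n)$ let $L\eta(x)=\int_{\mathbb R^n}[\eta(x)-\eta(z)]K(z-x)\,dz$ (principal value at $z=x$, i.e. $L\eta(x)=\frac12\int_{\mathbb R^n}[2\eta(x)-\eta(x+y)-\eta(x-y)]K(y)\,dy$). A solution of $L(f)=g$ in $\mathbb R^n$ (with $g\in L^1_{loc}(\mathbb R^n)$) is a continuous function $f$ that satisfies the equation weakly: $\int f\,L\eta=\int g\,\eta$ for all $\eta\in C_c^\infty(\mathbb R^n)$. Assume: (A) $K$ is nonnegative, even and measurable, $K\equiv 0$ in $\mathbb R^n\setminus B_1$, and $\int_{B_1}|y|^2K(y)\,dy<\infty$. (B) (Harnack inequality) For every $\Lambda$ there is $C>0$ such that, if $g$ is measurable with $|g|\le\Lambda$ and $f\ge0$ is a solution of $L(f)+g f=0$ in $\mathbb R^n$, then $\sup_{B_1(x_0)}f\le C\inf_{B_1(x_0)}f$ for all $x_0\in\mathbb R^n$. (C) (Hölder estimate) There are $\alpha\in(0,1)$ and $C>0$ such that, if $f$ is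 a bounded solution of $L(f)=g$ in $\mathbb R^n$ with $g$ bounded in $B_1$, then $\|f\|_{C^\alpha(B_{1/2})}\le C(\|g\|_{L^\infty(B_1)}+\|f\|_{L^\infty(\mathbb R^n)})$. Let $H=(H_i)_{i=1}^m$ be locally Lipschitz functions $H_i:\mathbb R^m\to\mathbb R$ and let $u=(u_i)_{i=1}^m$ be a solution of the system $L(u_i)=H_i(u)$ in $\mathbb R^n$, $1\le i\le m$, such that the partial derivatives $\partial_jH_i(u(x))$ exist for all $x\in\mathbb R^n$ and are bounded in $x$ (boundedness is automatic if $u$ is bounded). Suppose that the system is symmetric, i.e. the matrix $(\partial_jH_i(u(x)))_{i,j}$ is symmetric for every $x$, and orientable, i.e. there are constants $\theta_i\in\{-1,1\}$ with $\partial_jH_i(u(x))\,\theta_i\theta_j>0$ for all $i<j$ and all $x\in\mathbb R^n$. Suppose finally that the stability inequality $$\sum_{i,j=1}^m\int_{\mathbb R^n}\partial_jH_i(u)\,\zeta_i(x)\zeta_j(x)\,dx\le\frac12\sum_{i=1}^m\int_{\mathbb R^n}\int_{\mathbb R^n}[\zeta_i(x)-\zeta_i(z)]^2K(z-x)\,dz\,dx$$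 holds for all $\zeta_1,\dots,\zeta_m\in C_c^\infty(\mathbb R^n)$. Then $u$ is a stable solution: there are a constant $\lambda\ge0$ and continuous functions $\phi_1,\dots,\phi_m$ on $\mathbb R^n$, each of which is everywhere positive or everywhere negative, such that for every $i$ $$L(\phi_i)=\sum_{j=1}^m\partial_jH_i(u)\,\phi_j+\lambda\phi_i\quad\text{in }\mathbb R^n,$$ and $\partial_jH_i(u)\,\phi_j\phi_i>0$ in $\mathbb R^n$ for all $i<j$. -/

import Mathlib

open MeasureTheory Filter Topology
open scoped ContDiff

/-- The space `ℝⁿ` with its Euclidean norm. -/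
abbrev Rn (n : ℕ) : Type := EuclideanSpace ℝ (Fin n)

/-- Smooth functions with compact support. -/
def IsTestFunction {n : ℕ} (η : Rn n → ℝ) : Prop :=
  ContDiff ℝ ∞ η ∧ HasCompactSupport η

/-- The operator `L f (x) = ∫ (f x - f z) K (z - x) dz`, the integral being taken in the principal
value sense at `z = x`. For even `K` this is the symmetrised integral below; the two facts that
follow the definition record that it agrees with the displayed integral whenever that one converges
absolutely, and with its principal value otherwise. -/
noncomputable def nonlocalOp {n : ℕ} (K f : Rn n → ℝ) (x : Rn n) : ℝ :=
  (1 / 2) * ∫ y, (2 * f x - f (x + y) - f (x - y)) * K y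

theorem half_integral_symm {n : ℕ} {K f : Rn n → ℝ} (heven : ∀ y, K (-y) = K y) (x : Rn n)
    {S : Set (Rn n)} (hS : MeasurableSet S) (hsymm : ∀ y, -y ∈ S ↔ y ∈ S)
    (hint : IntegrableOn (fun y => (f x - f (x + y)) * K y) S) :
    (1 / 2) * ∫ y in S, (2 * f x - f (x + y) - f (x - y)) * K y
      = ∫ y in S, (f x - f (x + y)) * K y := by
  set F : Rn n → ℝ := S.indicator (fun y => (f x - f (x + y)) * K y) with hF
  have hFint : Integrable F := (integrable_indicator_iff hS).2 hint
  have hneg : ∀ y, F (-y) = S.indicator (fun y => (f x - f (x - y)) * K y) y := by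
    intro y
    by_cases hy : y ∈ S
    · simp [hF, Set.indicator_of_mem, hy, (hsymm y).2 hy, heven, sub_eq_add_neg]
    · have h2 : -y ∉ S := fun h => hy ((hsymm y).1 h)
      simp [hF, hy, h2]
  have hsum : S.indicator (fun y => (2 * f x - f (x + y) - f (x - y)) * K y)
      = fun y => F y + F (-y) := by
    funext y
    rw [hneg]
    by_cases hy : y ∈ S
    · simp only [hF, Set.indicator_of_mem hy]; ring
    · simp [hF, hy]
  rw [← integral_indicator hS, ← integral_indicator hS, hsum,
    integral_add hFint hFint.comp_neg, integral_neg_eq_self F volume]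
  ring

theorem nonlocalOp_eq_integral {n : ℕ} {K f : Rn n → ℝ} (heven : ∀ y, K (-y) = K y) (x : Rn n)
    (hint : Integrable (fun z => (f x - f z) * K (z - x))) :
    nonlocalOp K f x = ∫ z, (f x - f z) * K (z - x) := by
  have h1 : Integrable (fun y => (f x - f (x + y)) * K y) := by
    simpa using hint.comp_add_left x
  have h2 := half_integral_symm heven x MeasurableSet.univ (by simp)
    (integrableOn_univ.2 h1)
  rw [setIntegral_univ, setIntegral_univ] at h2
  rw [nonlocalOp, h2, ← integral_add_left_eq_self (fun z => (f x - f z) * K (z - x)) x]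
  simp

theorem tendsto_nonlocalOp {n : ℕ} {K f : Rn n → ℝ} (heven : ∀ y, K (-y) = K y)
    (x : Rn n)
    (hint : Integrable (fun y => (2 * f x - f (x + y) - f (x - y)) * K y))
    (htrunc : ∀ ε > 0, IntegrableOn (fun y => (f x - f (x + y)) * K y) {y | ε < ‖y‖}) :
    Tendsto (fun ε : ℝ => ∫ y in {y | ε < ‖y‖}, (f x - f (x + y)) * K y) (𝓝[>] 0)
      (𝓝 (nonlocalOp K f x)) := by
  have hmeas : ∀ ε : ℝ, MeasurableSet {y : Rn n | ε < ‖y‖} := fun ε =>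
    measurableSet_lt measurable_const measurable_norm
  have key : Tendsto (fun ε : ℝ => ∫ y in {y | ε < ‖y‖},
      (2 * f x - f (x + y) - f (x - y)) * K y) (𝓝[>] 0)
      (𝓝 (∫ y, (2 * f x - f (x + y) - f (x - y)) * K y)) := by
    simp_rw [← fun ε => integral_indicator (μ := volume)
      (f := fun y => (2 * f x - f (x + y) - f (x - y)) * K y) (hmeas ε)]
    refine tendsto_integral_filter_of_dominated_convergence
      (fun y => ‖(2 * f x - f (x + y) - f (x - y)) * K y‖) ?_ ?_ hint.norm ?_
    · exact Eventually.of_forall fun ε => hint.aestronglyMeasurable.indicator (hmeas ε)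
    · exact Eventually.of_forall fun ε => Eventually.of_forall fun y =>
        norm_indicator_le_norm_self _ _
    · refine Eventually.of_forall fun y => ?_
      by_cases hy : y = 0
      · subst hy
        refine tendsto_const_nhds.congr fun ε => ?_
        by_cases h : (0 : Rn n) ∈ {y : Rn n | ε < ‖y‖}
        · rw [Set.indicator_of_mem h]
        · rw [Set.indicator_of_notMem h]; simp; left; ring
      · refine tendsto_const_nhds.congr' ?_
        have : ∀ᶠ ε : ℝ in 𝓝[>] 0, ε < ‖y‖ :=
          mem_nhdsWithin_of_mem_nhds (Iio_mem_nhds (norm_pos_iff.2 hy))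
        filter_upwards [this] with ε hε
        rw [Set.indicator_of_mem (show y ∈ {y : Rn n | ε < ‖y‖} from hε)]
  refine (key.const_mul (1 / 2)).congr' ?_
  filter_upwards [self_mem_nhdsWithin] with ε hε
  exact half_integral_symm heven x (hmeas ε) (by simp) (htrunc ε hε)

/-- `f` is a solution of `L f = g` in `ℝⁿ`: `f` is continuous and the equation holds in the weak
(distributional) sense. -/
def IsSolution {n : ℕ} (K f g : Rn n → ℝ) : Prop :=
  Continuous f ∧ LocallyIntegrable g ∧
    ∀ η : Rn n → ℝ, IsTestFunction η → ∫ x, f x * nonlocalOp K η x = ∫ x, g x * η x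

/-- Condition (A): `K` is nonnegative, even, measurable, vanishes outside the unit ball, and has a
finite second moment. -/
structure KernelCondition {n : ℕ} (K : Rn n → ℝ) : Prop where
  nonneg : ∀ y, 0 ≤ K y
  even : ∀ y, K (-y) = K y
  measurable : Measurable K
  support : ∀ y, y ∉ Metric.ball (0 : Rn n) 1 → K y = 0
  moment : Integrable (fun y => ‖y‖ ^ 2 * K y)

/-- Condition (B), the Harnack inequality `sup f ≤ C inf f` on all unit balls for nonnegative
solutions of `L f + g f = 0` in `ℝⁿ`, with a constant that depends on the bounded function `g`
only through a bound for it. -/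
def HarnackCondition {n : ℕ} (K : Rn n → ℝ) : Prop :=
  ∀ Λ : ℝ, ∃ C : ℝ, 0 < C ∧ ∀ f g : Rn n → ℝ, Measurable g → (∀ x, |g x| ≤ Λ) →
    (∀ x, 0 ≤ f x) → IsSolution K f (fun x => -(g x * f x)) →
    ∀ x₀ : Rn n, ∀ x ∈ Metric.ball x₀ 1, ∀ y ∈ Metric.ball x₀ 1, f x ≤ C * f y

/-- Condition (C), the interior Hölder estimate
`‖f‖_{C^α(B_{1/2})} ≤ C (‖g‖_{L^∞(B_1)} + ‖f‖_{L^∞(ℝⁿ)})` for bounded solutions of `L f = g`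
in `ℝⁿ` with `g` bounded in `B_1`. -/
def HolderCondition {n : ℕ} (K : Rn n → ℝ) : Prop :=
  ∃ α C : ℝ, 0 < α ∧ α < 1 ∧ 0 < C ∧ ∀ (f g : Rn n → ℝ) (M N : ℝ),
    IsSolution K f g → (∀ x, |f x| ≤ M) → (∀ x ∈ Metric.ball (0 : Rn n) 1, |g x| ≤ N) →
    ∀ x ∈ Metric.ball (0 : Rn n) (1 / 2), ∀ y ∈ Metric.ball (0 : Rn n) (1 / 2),
    ∀ z ∈ Metric.ball (0 : Rn n) (1 / 2),
      |f x| + |f y - f z| / dist y z ^ α ≤ C * (N + M)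

/-- The value `u(x) = (u₁(x), …, u_m(x))`. -/
def valueAt {n m : ℕ} (u : Fin m → Rn n → ℝ) (x : Rn n) : Fin m → ℝ := fun k => u k x

/-- The matrix of the partial derivatives `∂_j H_i (u (x))` (row `i`, column `j`). -/
noncomputable def linearization {n m : ℕ} (H : Fin m → (Fin m → ℝ) → ℝ)
    (u : Fin m → Rn n → ℝ) (x : Rn n) : Matrix (Fin m) (Fin m) ℝ :=
  Matrix.of fun i j => lineDeriv ℝ (H i) (valueAt u x) (Pi.single j 1)

/-- `u` solves the system `L (u_i) = H_i (u)` in `ℝⁿ`, `1 ≤ i ≤ m`. -/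
def IsSystemSolution {n m : ℕ} (K : Rn n → ℝ) (H : Fin m → (Fin m → ℝ) → ℝ)
    (u : Fin m → Rn n → ℝ) : Prop :=
  ∀ i, IsSolution K (u i) (fun x => H i (valueAt u x))

/-- The system is symmetric (along `u`). -/
def IsSymmetricSystem {n m : ℕ} (H : Fin m → (Fin m → ℝ) → ℝ) (u : Fin m → Rn n → ℝ) : Prop :=
  ∀ x, (linearization H u x).IsSymm

/-- The system is orientable (along `u`). -/
def IsOrientableSystem {n m : ℕ} (H : Fin m → (Fin m → ℝ) → ℝ) (u : Fin m → Rn n → ℝ) : Prop :=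
  ∃ θ : Fin m → ℝ, (∀ i, θ i = -1 ∨ θ i = 1) ∧
    ∀ i j, i < j → ∀ x, 0 < linearization H u x i j * θ i * θ j

/-- The stability inequality for all test functions. -/
def StabilityInequality {n m : ℕ} (K : Rn n → ℝ) (H : Fin m → (Fin m → ℝ) → ℝ)
    (u : Fin m → Rn n → ℝ) : Prop :=
  ∀ ζ : Fin m → Rn n → ℝ, (∀ i, IsTestFunction (ζ i)) →
    ∑ i, ∑ j, ∫ x, linearization H u x i j * ζ i x * ζ j x
      ≤ (1 / 2) * ∑ i, ∫ x, ∫ z, (ζ i x - ζ i z) ^ 2 * K (z - x)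

/-- Stable solutions of the system. -/
def IsStableSolution {n m : ℕ} (K : Rn n → ℝ) (H : Fin m → (Fin m → ℝ) → ℝ)
    (u : Fin m → Rn n → ℝ) : Prop :=
  IsSystemSolution K H u ∧
  ∃ (φ : Fin m → Rn n → ℝ) (lam : ℝ), 0 ≤ lam ∧
    (∀ i, (∀ x, 0 < φ i x) ∨ (∀ x, φ i x < 0)) ∧
    (∀ i, IsSolution K (φ i)
      (fun x => ∑ j, linearization H u x i j * φ j x + lam * φ i x)) ∧
    ∀ i j, i < j → ∀ x, 0 < linearization H u x i j * φ j x * φ i x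

/-! After replacing each unknown by its multiple with the orientation sign θ_i, the linearised
matrix A = (∂_jH_i(u) θ_iθ_j) is bounded and symmetric with positive off-diagonal entries, and the
stability inequality says that L − A is a nonnegative quadratic form on test functions. The goal
becomes a positive solution of Lφ_i = Σ_j A_ij φ_j; the constant λ of the conclusion is then 0.

Since (B) and (C) concern solutions in the whole space, the construction does not exhaust ℝⁿ by
balls. For μ > 0 the operator L − A + μ is coercive in L², so (L − A + μ)w = b is solved by
minimising a quadratic functional over test functions (`exists_weak_minimizer`). When b ≥ 0, passing
to absolute values does not raise the functional, because A is cooperative and contractions lower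
the energy; hence w ≥ 0 (`exists_resolvent`). A suitable b gives u with (L − A + μ)u equal to a
multiple of a Gaussian and u at least that Gaussian (`exists_solution_gaussian_source`). The source
is thus controlled by u itself, so the sum of the components satisfies |Lv| ≤ Λv after mollification
and obeys the Harnack inequality with uniform constants.

Let μ → 0 and move the centre of the Gaussian to distance k. Normalising at the origin costs at most
a factor exponential in k, by a Harnack chain, while the source near the origin is of size
exp(−k²/4), so the normalised source disappears (`exists_approximations`). The Hölder estimate gives
compactness, and the limit is a nonnegative, nontrivial, continuous solution
(`exists_nonneg_solution`).

By a strong maximum principle (`IsWeakSolution.eq_zero_of_exists_zero`) each component is positive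
or identically zero. A zero component beside a positive one contradicts its own equation, because
the coupling A_ij is positive (`exists_pos_solution`). -/

/-! ### Second differences and the operator on smooth functions -/

/-- The symmetric second difference `2 f(x) - f(x+y) - f(x-y)`. -/
def secondDiff {n : ℕ} (f : Rn n → ℝ) (x y : Rn n) : ℝ := 2 * f x - f (x + y) - f (x - y)

theorem nonlocalOp_eq_secondDiff {n : ℕ} (K f : Rn n → ℝ) (x : Rn n) :
    nonlocalOp K f x = (1 / 2) * ∫ y, secondDiff f x y * K y := rfl

theorem IsTestFunction.continuous {n : ℕ} {η : Rn n → ℝ} (h : IsTestFunction η) :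
    Continuous η := h.1.continuous

theorem IsTestFunction.contDiff_two {n : ℕ} {η : Rn n → ℝ} (h : IsTestFunction η) :
    ContDiff ℝ 2 η := contDiff_infty.1 h.1 2

theorem IsTestFunction.exists_bound {n : ℕ} {η : Rn n → ℝ} (h : IsTestFunction η) :
    ∃ C, 0 ≤ C ∧ ∀ x, |η x| ≤ C := by
  obtain ⟨C, hC⟩ := h.2.exists_bound_of_continuous h.continuous
  exact ⟨C, (norm_nonneg _).trans (hC 0), hC⟩

theorem IsTestFunction.exists_radius {n : ℕ} {η : Rn n → ℝ} (h : IsTestFunction η) :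
    ∃ R, 0 < R ∧ ∀ x, R < ‖x‖ → η x = 0 := by
  obtain ⟨R, hR, hs⟩ := h.2.isCompact.isBounded.subset_closedBall_lt 0 0
  refine ⟨R, hR, fun x hx => image_eq_zero_of_notMem_tsupport fun hm => ?_⟩
  have := hs hm
  simp at this
  linarith

/-- On a compact ball the derivative of v is Lipschitz. A second difference is an increment of z ↦
v(z + y) − v(z), whose derivative is O(‖y‖), along a segment of length ‖y‖. -/
theorem exists_abs_secondDiff_le {n : ℕ} {v : Rn n → ℝ} (hv : ContDiff ℝ 2 v) (R : ℝ) :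
    ∃ C, 0 ≤ C ∧ ∀ x y, ‖x‖ ≤ R → ‖y‖ ≤ 1 → |secondDiff v x y| ≤ C * ‖y‖ ^ 2 := by
  have h1 : ContDiff ℝ 1 (fderiv ℝ v) := hv.fderiv_right (by norm_num)
  have hd : Differentiable ℝ v := hv.differentiable (by norm_num)
  obtain ⟨C, hC⟩ := (isCompact_closedBall (0 : Rn n) (R + 1)).exists_bound_of_continuousOn
    (h1.continuous_fderiv (by norm_num)).continuousOn
  have hlip : ∀ a ∈ Metric.closedBall (0 : Rn n) (R + 1), ∀ b ∈ Metric.closedBall (0 : Rn n) (R + 1),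
      ‖fderiv ℝ v b - fderiv ℝ v a‖ ≤ C * ‖b - a‖ := fun a ha b hb =>
    (convex_closedBall (0 : Rn n) (R + 1)).norm_image_sub_le_of_norm_fderiv_le
      (fun x _ => h1.differentiable (by norm_num) x) hC ha hb
  refine ⟨max C 0, le_max_right _ _, fun x y hx hy => ?_⟩
  have hmem : ∀ z, ‖z - x‖ ≤ 1 → z ∈ Metric.closedBall (0 : Rn n) (R + 1) := by
    intro z hz
    rw [mem_closedBall_zero_iff]
    calc ‖z‖ = ‖x + (z - x)‖ := by congr 1; abel
      _ ≤ ‖x‖ + ‖z - x‖ := norm_add_le _ _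
      _ ≤ R + 1 := by linarith
  -- The second difference is, up to sign, g(x) − g(x − y); the mean value inequality is applied on
  -- the segment from x − y to x.
  set g : Rn n → ℝ := fun z => v (z + y) - v z with hg
  have hderiv : ∀ z, HasFDerivAt g (fderiv ℝ v (z + y) - fderiv ℝ v z) z := by
    intro z
    have h2 : HasFDerivAt (fun z => v (z + y)) (fderiv ℝ v (z + y)) z := by
      rw [hasFDerivAt_comp_add_right]
      exact (hd (z + y)).hasFDerivAt
    exact h2.sub (hd z).hasFDerivAt
  have hseg : ∀ z ∈ segment ℝ (x - y) x, ‖z - x‖ ≤ 1 ∧ ‖z + y - x‖ ≤ 1 := by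
    rintro z ⟨a, b, ha, hb, hab, rfl⟩
    have e1 : a • (x - y) + b • x - x = -(a • y) := by
      have : b = 1 - a := by linarith
      subst this; module
    have e2 : a • (x - y) + b • x + y - x = b • y := by
      have : b = 1 - a := by linarith
      subst this; module
    rw [e1, e2, norm_neg, norm_smul, norm_smul, Real.norm_of_nonneg ha, Real.norm_of_nonneg hb]
    constructor <;> nlinarith [norm_nonneg y]
  have hmv := (convex_segment (𝕜 := ℝ) (x - y) x).norm_image_sub_le_of_norm_hasFDerivWithin_le
    (f := g) (C := max C 0 * ‖y‖) (fun z _ => (hderiv z).hasFDerivWithinAt) (by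
      intro z hz
      obtain ⟨ha, hb⟩ := hseg z hz
      refine (hlip z (hmem z ha) (z + y) (hmem _ hb)).trans ?_
      rw [add_sub_cancel_left]
      exact mul_le_mul_of_nonneg_right (le_max_left _ _) (norm_nonneg _))
    (left_mem_segment ℝ _ _) (right_mem_segment ℝ _ _)
  have e : g x - g (x - y) = - secondDiff v x y := by
    simp only [hg, secondDiff, sub_add_cancel]; ring
  rw [e, norm_neg, sub_sub_cancel, Real.norm_eq_abs] at hmv
  calc _ ≤ _ := hmv
    _ = _ := by ring

theorem IsTestFunction.secondDiff_eq_zero {n : ℕ} {η : Rn n → ℝ} {R : ℝ}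
    (hR : ∀ x, R < ‖x‖ → η x = 0) {x y : Rn n} (hx : R + 1 < ‖x‖) (hy : ‖y‖ ≤ 1) :
    secondDiff η x y = 0 := by
  have h1 : ‖x‖ ≤ ‖x + y‖ + ‖y‖ := by simpa using norm_sub_le (x + y) y
  have h2 : ‖x‖ ≤ ‖x - y‖ + ‖y‖ := by simpa using norm_add_le (x - y) y
  rw [secondDiff, hR x (by linarith), hR (x + y) (by linarith), hR (x - y) (by linarith)]
  simp

theorem IsTestFunction.exists_abs_secondDiff_le {n : ℕ} {η : Rn n → ℝ} (h : IsTestFunction η) :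
    ∃ C R, 0 ≤ C ∧ 0 < R ∧ (∀ x, R < ‖x‖ → η x = 0) ∧
      ∀ x y, ‖y‖ ≤ 1 →
        |secondDiff η x y| ≤ (Metric.closedBall (0 : Rn n) R).indicator (fun _ => C) x * ‖y‖ ^ 2 := by
  obtain ⟨R, hR, hz⟩ := h.exists_radius
  obtain ⟨C, hC, hb⟩ := _root_.exists_abs_secondDiff_le h.contDiff_two (R + 1)
  refine ⟨C, R + 1, hC, by linarith, fun x hx => hz x (by linarith), fun x y hy => ?_⟩
  by_cases hx : ‖x‖ ≤ R + 1
  · rw [Set.indicator_of_mem (by simpa using hx)]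
    exact hb x y hx hy
  · rw [Set.indicator_of_notMem (by simpa using hx), secondDiff_eq_zero hz (not_le.1 hx) hy]
    simp

/-! ### Integrability against the kernel -/

section Kernel

variable {n : ℕ} {K : Rn n → ℝ}

theorem KernelCondition.eq_zero_of_one_le (hA : KernelCondition K) {y : Rn n} (hy : 1 ≤ ‖y‖) :
    K y = 0 := hA.support y (by simpa using hy)

/-- The kernel vanishes off the unit ball, so quadratic control for small y is enough for domination
by the second moment. -/
theorem KernelCondition.abs_mul_le (hA : KernelCondition K) {C s : ℝ} {y : Rn n}
    (h : ‖y‖ ≤ 1 → |s| ≤ C * ‖y‖ ^ 2) : |s * K y| ≤ C * (‖y‖ ^ 2 * K y) := by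
  by_cases hy : ‖y‖ ≤ 1
  · rw [abs_mul, abs_of_nonneg (hA.nonneg y), ← mul_assoc]
    exact mul_le_mul_of_nonneg_right (h hy) (hA.nonneg y)
  · rw [hA.eq_zero_of_one_le (not_le.1 hy).le]; simp

theorem KernelCondition.moment_nonneg (hA : KernelCondition K) : 0 ≤ ∫ y, ‖y‖ ^ 2 * K y :=
  integral_nonneg fun y => mul_nonneg (by positivity) (hA.nonneg y)

theorem continuous_secondDiff {v : Rn n → ℝ} (hv : Continuous v) :
    Continuous (fun p : Rn n × Rn n => secondDiff v p.1 p.2) := by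
  unfold secondDiff; fun_prop

theorem KernelCondition.integrable_secondDiff (hA : KernelCondition K) {v : Rn n → ℝ}
    (hv : ContDiff ℝ 2 v) (x : Rn n) : Integrable (fun y => secondDiff v x y * K y) := by
  obtain ⟨C, hC, hb⟩ := exists_abs_secondDiff_le hv ‖x‖
  refine (hA.moment.const_mul C).mono' ?_ (Eventually.of_forall fun y => ?_)
  · have : Continuous (fun y => secondDiff v x y) := by
      have := hv.continuous
      unfold secondDiff; fun_prop
    exact (this.measurable.mul hA.measurable).aestronglyMeasurable
  · exact hA.abs_mul_le fun hy => hb x y le_rfl hy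

theorem KernelCondition.abs_nonlocalOp_le (hA : KernelCondition K) {v : Rn n → ℝ} {x : Rn n}
    {C : ℝ} (h : ∀ y, ‖y‖ ≤ 1 → |secondDiff v x y| ≤ C * ‖y‖ ^ 2) :
    |nonlocalOp K v x| ≤ C * ∫ y, ‖y‖ ^ 2 * K y := by
  have h1 : |∫ y, secondDiff v x y * K y| ≤ ∫ y, C * (‖y‖ ^ 2 * K y) :=
    norm_integral_le_of_norm_le (f := fun y => secondDiff v x y * K y) (hA.moment.const_mul C)
      (Eventually.of_forall fun y => hA.abs_mul_le (h y))
  rw [integral_const_mul] at h1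
  rw [nonlocalOp_eq_secondDiff, abs_mul, abs_of_pos (by norm_num : (0 : ℝ) < 1 / 2)]
  linarith [abs_nonneg (∫ y, secondDiff v x y * K y)]

theorem KernelCondition.measurable_nonlocalOp (hA : KernelCondition K) {v : Rn n → ℝ}
    (hv : Continuous v) : Measurable (nonlocalOp K v) := by
  have : StronglyMeasurable (fun x => ∫ y, secondDiff v x y * K y) := by
    apply StronglyMeasurable.integral_prod_right (f := fun x y => secondDiff v x y * K y)
    exact ((continuous_secondDiff hv).measurable.mul
      (hA.measurable.comp measurable_snd)).stronglyMeasurable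
  exact (this.measurable.const_mul (1 / 2))

theorem KernelCondition.exists_abs_nonlocalOp_le (hA : KernelCondition K) {v : Rn n → ℝ}
    (hv : ContDiff ℝ 2 v) (R : ℝ) : ∃ C, 0 ≤ C ∧ ∀ x, ‖x‖ ≤ R → |nonlocalOp K v x| ≤ C := by
  obtain ⟨C, hC, hb⟩ := exists_abs_secondDiff_le hv R
  exact ⟨C * ∫ y, ‖y‖ ^ 2 * K y, mul_nonneg hC hA.moment_nonneg,
    fun x hx => hA.abs_nonlocalOp_le fun y hy => hb x y hx hy⟩

/-- A measurable function that is bounded on balls is locally integrable. -/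
theorem locallyIntegrable_of_bounded_on_balls {f : Rn n → ℝ} (hf : Measurable f)
    (hb : ∀ R : ℝ, ∃ C, ∀ x, ‖x‖ ≤ R → |f x| ≤ C) : LocallyIntegrable f := by
  rw [locallyIntegrable_iff]
  intro k hk
  obtain ⟨R, hR⟩ := hk.isBounded.subset_closedBall 0
  obtain ⟨C, hC⟩ := hb R
  refine Measure.integrableOn_of_bounded (M := C) hk.measure_lt_top.ne
    hf.aestronglyMeasurable ?_
  filter_upwards [ae_restrict_mem hk.measurableSet] with x hx
  exact hC x (by simpa using hR hx)

theorem KernelCondition.locallyIntegrable_nonlocalOp (hA : KernelCondition K) {v : Rn n → ℝ}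
    (hv : ContDiff ℝ 2 v) : LocallyIntegrable (nonlocalOp K v) :=
  locallyIntegrable_of_bounded_on_balls (hA.measurable_nonlocalOp hv.continuous) fun R =>
    let ⟨C, _, h⟩ := hA.exists_abs_nonlocalOp_le hv R
    ⟨C, h⟩

theorem KernelCondition.nonlocalOp_add (hA : KernelCondition K) {v w : Rn n → ℝ}
    (hv : ContDiff ℝ 2 v) (hw : ContDiff ℝ 2 w) (x : Rn n) :
    nonlocalOp K (fun z => v z + w z) x = nonlocalOp K v x + nonlocalOp K w x := by
  simp only [nonlocalOp_eq_secondDiff]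
  rw [← mul_add, ← integral_add (hA.integrable_secondDiff hv x) (hA.integrable_secondDiff hw x)]
  congr 2; ext y; simp only [secondDiff]; ring

theorem nonlocalOp_const_mul (K : Rn n → ℝ) (c : ℝ) (v : Rn n → ℝ) (x : Rn n) :
    nonlocalOp K (fun z => c * v z) x = c * nonlocalOp K v x := by
  simp only [nonlocalOp_eq_secondDiff]
  rw [mul_left_comm c, ← integral_const_mul c]
  congr 2
  ext y
  simp only [secondDiff]; ring

theorem nonlocalOp_zero (K : Rn n → ℝ) (x : Rn n) : nonlocalOp K (fun _ => 0) x = 0 := by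
  simp [nonlocalOp_eq_secondDiff, secondDiff]

theorem KernelCondition.nonlocalOp_sum (hA : KernelCondition K) {ι : Type*} (s : Finset ι)
    {v : ι → Rn n → ℝ} (hv : ∀ i, ContDiff ℝ 2 (v i)) (x : Rn n) :
    nonlocalOp K (fun z => ∑ i ∈ s, v i z) x = ∑ i ∈ s, nonlocalOp K (v i) x := by
  classical
  induction s using Finset.induction_on with
  | empty => simpa using nonlocalOp_zero K x
  | insert a s ha ih =>
    simp only [Finset.sum_insert ha]
    rw [hA.nonlocalOp_add (hv a) (ContDiff.sum fun i _ => hv i), ih]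

theorem nonlocalOp_comp_add_right (K : Rn n → ℝ) (v : Rn n → ℝ) (a x : Rn n) :
    nonlocalOp K (fun z => v (z + a)) x = nonlocalOp K v (x + a) := by
  simp only [nonlocalOp, add_right_comm x a, sub_add_eq_add_sub]

/-- The operator at `x` depends only on the values in the unit ball about `x`. -/
theorem KernelCondition.nonlocalOp_congr (hA : KernelCondition K) {v w : Rn n → ℝ} {x : Rn n}
    (h : ∀ z, dist z x < 1 → v z = w z) : nonlocalOp K v x = nonlocalOp K w x := by
  simp only [nonlocalOp]
  congr 2; ext y
  by_cases hy : ‖y‖ < 1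
  · rw [h x (by simp), h (x + y) (by simpa [dist_eq_norm] using hy),
      h (x - y) (by simpa [dist_eq_norm] using hy)]
  · rw [hA.eq_zero_of_one_le (not_lt.1 hy)]; simp

/-! ### Symmetry of the operator -/

theorem KernelCondition.integrable_prod_mul_secondDiff (hA : KernelCondition K) {f η : Rn n → ℝ}
    (hf : LocallyIntegrable f) (hη : IsTestFunction η) :
    Integrable (fun p : Rn n × Rn n => f p.1 * (secondDiff η p.1 p.2 * K p.2))
      (volume.prod volume) := by
  obtain ⟨C, R, hC, hR, hz, hb⟩ := hη.exists_abs_secondDiff_le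
  have h1 : Integrable ((Metric.closedBall (0 : Rn n) R).indicator (fun x => ‖f x‖ * C)) :=
    (integrable_indicator_iff measurableSet_closedBall).2
      ((hf.integrableOn_isCompact (isCompact_closedBall _ _)).norm.mul_const C)
  refine (h1.mul_prod hA.moment).mono' ?_ (Eventually.of_forall fun p => ?_)
  · exact hf.aestronglyMeasurable.comp_fst.mul
      ((continuous_secondDiff hη.continuous).measurable.mul
        (hA.measurable.comp measurable_snd)).aestronglyMeasurable
  · have h2 := hA.abs_mul_le (hb p.1 p.2)
    rw [norm_mul, Real.norm_eq_abs (secondDiff _ _ _ * _)]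
    refine (mul_le_mul_of_nonneg_left h2 (norm_nonneg _)).trans (le_of_eq ?_)
    by_cases hp : p.1 ∈ Metric.closedBall (0 : Rn n) R
    · simp only [Set.indicator_of_mem hp]; ring
    · simp only [Set.indicator_of_notMem hp]; simp

theorem KernelCondition.integrable_prod_secondDiff_mul (hA : KernelCondition K) {v η : Rn n → ℝ}
    (hv : ContDiff ℝ 2 v) (hη : IsTestFunction η) :
    Integrable (fun p : Rn n × Rn n => η p.1 * (secondDiff v p.1 p.2 * K p.2))
      (volume.prod volume) := by
  obtain ⟨R, hR, hz⟩ := hη.exists_radius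
  obtain ⟨C, hC, hb⟩ := exists_abs_secondDiff_le hv R
  have h1 : Integrable (fun x => ‖η x‖ * C) :=
    (hη.continuous.integrable_of_hasCompactSupport hη.2).norm.mul_const C
  refine (h1.mul_prod hA.moment).mono' ?_ (Eventually.of_forall fun p => ?_)
  · exact (hη.continuous.comp continuous_fst).aestronglyMeasurable.mul
      ((continuous_secondDiff hv.continuous).measurable.mul
        (hA.measurable.comp measurable_snd)).aestronglyMeasurable
  · rw [norm_mul, Real.norm_eq_abs (secondDiff _ _ _ * _)]
    by_cases hp : ‖p.1‖ ≤ R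
    · have h2 := hA.abs_mul_le fun hy => hb p.1 p.2 hp hy
      refine (mul_le_mul_of_nonneg_left h2 (norm_nonneg _)).trans (le_of_eq (by ring))
    · rw [hz _ (not_le.1 hp)]; simp

theorem integral_two_mul_sub_sub {a b c : Rn n → ℝ} (ha : Integrable a) (hb : Integrable b)
    (hc : Integrable c) :
    ∫ x, (2 * a x - b x - c x) = 2 * (∫ x, a x) - (∫ x, b x) - ∫ x, c x := by
  have h : Integrable (fun x => 2 * a x - b x) := (ha.const_mul 2).sub hb
  rw [integral_sub h hc, integral_sub (ha.const_mul 2) hb, integral_const_mul]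

theorem integral_mul_secondDiff_comm {v η : Rn n → ℝ} (hv : Continuous v)
    (hη : IsTestFunction η) (y : Rn n) :
    ∫ x, v x * secondDiff η x y = ∫ x, η x * secondDiff v x y := by
  have hi : ∀ (f g : Rn n → ℝ), Continuous f → Continuous g → HasCompactSupport g →
      Integrable (fun x => f x * g x) := fun f g hf hg hs =>
    (hf.mul hg).integrable_of_hasCompactSupport hs.mul_left
  have hp : HasCompactSupport (fun x => η (x + y)) :=
    hη.2.comp_homeomorph (Homeomorph.addRight y)
  have hm : HasCompactSupport (fun x => η (x - y)) :=
    hη.2.comp_homeomorph (Homeomorph.subRight y)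
  have hc := hη.continuous
  have e1 : ∫ x, v x * η (x + y) = ∫ x, η x * v (x - y) := by
    rw [← integral_sub_right_eq_self _ y]
    congr 1; ext x; simp [mul_comm]
  have e2 : ∫ x, v x * η (x - y) = ∫ x, η x * v (x + y) := by
    rw [← integral_add_right_eq_self _ y]
    congr 1; ext x; simp [mul_comm]
  have i1 := hi v η hv hc hη.2
  have i2 := hi v (fun x => η (x + y)) hv (by fun_prop) hp
  have i3 := hi v (fun x => η (x - y)) hv (by fun_prop) hm
  have i4 := hi (fun x => v (x + y)) η (by fun_prop) hc hη.2
  have i5 := hi (fun x => v (x - y)) η (by fun_prop) hc hη.2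
  calc ∫ x, v x * secondDiff η x y
      = ∫ x, (2 * (v x * η x) - v x * η (x + y) - v x * η (x - y)) := by
        congr 1; ext x; simp only [secondDiff]; ring
    _ = 2 * (∫ x, v x * η x) - (∫ x, v x * η (x + y)) - ∫ x, v x * η (x - y) :=
integral_two_mul_sub_sub i1 i2 i3
    _ = 2 * (∫ x, v x * η x) - (∫ x, v (x + y) * η x) - ∫ x, v (x - y) * η x := by
        rw [e1, e2]; simp only [mul_comm (η _)]; ring
    _ = ∫ x, (2 * (v x * η x) - v (x + y) * η x - v (x - y) * η x) :=
        (integral_two_mul_sub_sub i1 i4 i5).symm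
    _ = _ := by congr 1; ext x; simp only [secondDiff]; ring

theorem integral_mul_nonlocalOp (K f v : Rn n → ℝ) :
    ∫ x, f x * nonlocalOp K v x = (1 / 2) * ∫ x, ∫ y, f x * (secondDiff v x y * K y) := by
  simp only [nonlocalOp_eq_secondDiff, integral_const_mul]
  rw [← integral_const_mul]
  congr 1; ext x; ring

/-- Fubini reduces the symmetry to a fixed y, where it is translation invariance of Lebesgue
measure. Only η needs compact support, so C² functions such as the Gaussian also become weak
solutions. -/
theorem KernelCondition.integral_mul_nonlocalOp_comm (hA : KernelCondition K) {v η : Rn n → ℝ}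
    (hv : ContDiff ℝ 2 v) (hη : IsTestFunction η) :
    ∫ x, v x * nonlocalOp K η x = ∫ x, nonlocalOp K v x * η x := by
  simp only [mul_comm (nonlocalOp K v _)]
  rw [integral_mul_nonlocalOp, integral_mul_nonlocalOp,
    integral_integral_swap (f := fun x y => v x * (secondDiff η x y * K y))
      (hA.integrable_prod_mul_secondDiff hv.continuous.locallyIntegrable hη),
    integral_integral_swap (f := fun x y => η x * (secondDiff v x y * K y))
      (hA.integrable_prod_secondDiff_mul hv hη)]
  congr 2; ext y
  simp only [← mul_assoc, integral_mul_const]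
  rw [integral_mul_secondDiff_comm hv.continuous hη]

theorem KernelCondition.isSolution_nonlocalOp (hA : KernelCondition K) {v : Rn n → ℝ}
    (hv : ContDiff ℝ 2 v) : IsSolution K v (nonlocalOp K v) :=
  ⟨hv.continuous, hA.locallyIntegrable_nonlocalOp hv, fun _ hη =>
    hA.integral_mul_nonlocalOp_comm hv hη⟩

end Kernel

/-! ### The energy of a test function -/

section Energy

variable {n : ℕ} {K : Rn n → ℝ}

theorem KernelCondition.integrable_energy (hA : KernelCondition K) {ζ : Rn n → ℝ}
    (hζ : IsTestFunction ζ) :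
    Integrable (fun p : Rn n × Rn n => (ζ p.1 - ζ (p.1 + p.2)) ^ 2 * K p.2)
      (volume.prod volume) := by
  obtain ⟨R, hR, hz⟩ := hζ.exists_radius
  obtain ⟨C, hC⟩ := ContDiff.lipschitzWith_of_hasCompactSupport hζ.2 hζ.1 (by simp)
  have h1 : Integrable ((Metric.closedBall (0 : Rn n) (R + 1)).indicator
      (fun _ : Rn n => (C : ℝ) ^ 2)) :=
    (integrable_indicator_iff measurableSet_closedBall).2
      (integrableOn_const (isCompact_closedBall _ _).measure_lt_top.ne)
  refine (h1.mul_prod hA.moment).mono' ?_ (Eventually.of_forall fun p => ?_)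
  · have := hζ.continuous
    have h2 : Continuous (fun p : Rn n × Rn n => (ζ p.1 - ζ (p.1 + p.2)) ^ 2) := by fun_prop
    exact (h2.measurable.mul (hA.measurable.comp measurable_snd)).aestronglyMeasurable
  · refine hA.abs_mul_le fun hy => ?_
    by_cases hp : ‖p.1‖ ≤ R + 1
    · rw [Set.indicator_of_mem (by simpa using hp), abs_of_nonneg (sq_nonneg _), ← mul_pow,
        ← sq_abs]
      have h4 : |ζ p.1 - ζ (p.1 + p.2)| ≤ C * ‖p.2‖ := by
        simpa [Real.dist_eq] using hC.dist_le_mul p.1 (p.1 + p.2)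
      exact pow_le_pow_left₀ (abs_nonneg _) h4 2
    · have h5 : ‖p.1‖ ≤ ‖p.1 + p.2‖ + ‖p.2‖ := by simpa using norm_sub_le (p.1 + p.2) p.2
      rw [Set.indicator_of_notMem (by simpa using hp), hz p.1 (by linarith),
        hz (p.1 + p.2) (by linarith)]
      simp

theorem KernelCondition.iterated_energy (hA : KernelCondition K) {ζ : Rn n → ℝ}
    (hζ : IsTestFunction ζ) :
    ∫ x, ∫ z, (ζ x - ζ z) ^ 2 * K (z - x)
      = ∫ p : Rn n × Rn n, (ζ p.1 - ζ (p.1 + p.2)) ^ 2 * K p.2 ∂(volume.prod volume) := by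
  rw [integral_prod _ (hA.integrable_energy hζ)]
  congr 1; ext x
  rw [← integral_add_left_eq_self _ x]
  simp

/-- Expand the square and translate by y: the two shifted squares have equal integrals, and the
cross term splits evenly between the shifts by y and −y. -/
theorem integral_sq_sub_translate {ζ : Rn n → ℝ} (hζ : IsTestFunction ζ) (y : Rn n) :
    ∫ x, (ζ x - ζ (x + y)) ^ 2 = ∫ x, ζ x * secondDiff ζ x y := by
  have hc := hζ.continuous
  have hi : ∀ g : Rn n → ℝ, Continuous g → Integrable (fun x => ζ x * g x) := fun g hg =>
    (hc.mul hg).integrable_of_hasCompactSupport hζ.2.mul_right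
  have i1 := hi ζ hc
  have i2 := hi (fun x => ζ (x + y)) (by fun_prop)
  have i3 := hi (fun x => ζ (x - y)) (by fun_prop)
  have i4 : Integrable (fun x => ζ (x + y) * ζ (x + y)) := i1.comp_add_right y
  have e1 : ∫ x, ζ (x + y) * ζ (x + y) = ∫ x, ζ x * ζ x :=
    integral_add_right_eq_self (fun x => ζ x * ζ x) y
  have e2 : ∫ x, ζ x * ζ (x + y) = ∫ x, ζ x * ζ (x - y) := by
    rw [← integral_sub_right_eq_self _ y]
    congr 1; ext x; simp [mul_comm]
  have i5 : Integrable (fun x => 2 * (ζ x * ζ x) - ζ x * ζ (x + y)) := (i1.const_mul 2).sub i2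
  have i6 : Integrable (fun x => ζ x * ζ x - 2 * (ζ x * ζ (x + y))) := i1.sub (i2.const_mul 2)
  calc ∫ x, (ζ x - ζ (x + y)) ^ 2
      = ∫ x, (ζ x * ζ x - 2 * (ζ x * ζ (x + y)) + ζ (x + y) * ζ (x + y)) := by
        congr 1; ext x; ring
    _ = (∫ x, ζ x * ζ x) - 2 * (∫ x, ζ x * ζ (x + y)) + ∫ x, ζ (x + y) * ζ (x + y) := by
        rw [integral_add i6 i4, integral_sub i1 (i2.const_mul 2), integral_const_mul]
    _ = 2 * (∫ x, ζ x * ζ x) - (∫ x, ζ x * ζ (x + y)) - ∫ x, ζ x * ζ (x - y) := by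
        rw [e1, ← e2]; ring
    _ = ∫ x, (2 * (ζ x * ζ x) - ζ x * ζ (x + y) - ζ x * ζ (x - y)) :=
        (integral_two_mul_sub_sub i1 i2 i3).symm
    _ = _ := by congr 1; ext x; simp only [secondDiff]; ring

theorem KernelCondition.energy_eq (hA : KernelCondition K) {ζ : Rn n → ℝ}
    (hζ : IsTestFunction ζ) :
    (1 / 2) * ∫ p : Rn n × Rn n, (ζ p.1 - ζ (p.1 + p.2)) ^ 2 * K p.2 ∂(volume.prod volume)
      = ∫ x, ζ x * nonlocalOp K ζ x := by
  rw [integral_mul_nonlocalOp,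
    integral_integral_swap (f := fun x y => ζ x * (secondDiff ζ x y * K y))
      (hA.integrable_prod_mul_secondDiff hζ.continuous.locallyIntegrable hζ),
    integral_prod_symm _ (hA.integrable_energy hζ)]
  congr 2; ext y
  simp only [← mul_assoc, integral_mul_const]
  rw [integral_sq_sub_translate hζ]

/-- The energy decreases under contractions of the values. -/
theorem KernelCondition.energy_le_of_contraction (hA : KernelCondition K) {ζ w : Rn n → ℝ}
    (hζ : IsTestFunction ζ) (hw : IsTestFunction w) (h : ∀ x z, |w x - w z| ≤ |ζ x - ζ z|) :
    ∫ x, w x * nonlocalOp K w x ≤ ∫ x, ζ x * nonlocalOp K ζ x := by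
  rw [← hA.energy_eq hζ, ← hA.energy_eq hw]
  refine mul_le_mul_of_nonneg_left (integral_mono (hA.integrable_energy hw)
    (hA.integrable_energy hζ) fun p => ?_) (by norm_num)
  exact mul_le_mul_of_nonneg_right (sq_le_sq.2 (h _ _)) (hA.nonneg _)

end Energy

/-! ### Distributional solutions and their mollifications -/

/-- `f` is a locally integrable distributional solution of `L f = F`. -/
structure IsWeakSolution {n : ℕ} (K f F : Rn n → ℝ) : Prop where
  left : LocallyIntegrable f
  right : LocallyIntegrable F
  eq : ∀ η : Rn n → ℝ, IsTestFunction η → ∫ x, f x * nonlocalOp K η x = ∫ x, F x * η x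

theorem IsSolution.isWeakSolution {n : ℕ} {K f F : Rn n → ℝ} (h : IsSolution K f F) :
    IsWeakSolution K f F := ⟨h.1.locallyIntegrable, h.2.1, h.2.2⟩

/-- A sequence of bump functions shrinking to the origin. -/
noncomputable def shrinkingBump (n j : ℕ) : ContDiffBump (0 : Rn n) where
  rIn := 1 / (j + 1) / 2
  rOut := 1 / (j + 1)
  rIn_pos := by positivity
  rIn_lt_rOut := half_lt_self (by positivity)

/-- The mollification of `f` at scale `1 / (j + 1)`. -/
noncomputable def mollify {n : ℕ} (j : ℕ) (f : Rn n → ℝ) : Rn n → ℝ :=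
  MeasureTheory.convolution ((shrinkingBump n j).normed volume) f
    (ContinuousLinearMap.lsmul ℝ ℝ) volume

section Mollify

variable {n : ℕ}

/-- The mollifying kernel. -/
noncomputable def mollifier (n j : ℕ) : Rn n → ℝ := (shrinkingBump n j).normed volume

theorem isTestFunction_mollifier (n j : ℕ) : IsTestFunction (mollifier n j) :=
  ⟨(shrinkingBump n j).contDiff_normed, (shrinkingBump n j).hasCompactSupport_normed⟩

theorem mollifier_nonneg (j : ℕ) (x : Rn n) : 0 ≤ mollifier n j x :=
  (shrinkingBump n j).nonneg_normed x

theorem mollifier_eq_zero {j : ℕ} {x : Rn n} (hx : 1 ≤ ‖x‖) : mollifier n j x = 0 := by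
  have : x ∉ Function.support ((shrinkingBump n j).normed volume) := by
    rw [ContDiffBump.support_normed_eq]
    have : (1 : ℝ) / (j + 1) ≤ 1 := by
      rw [div_le_one (by positivity)]; linarith [(Nat.cast_nonneg j : (0 : ℝ) ≤ j)]
    simp [shrinkingBump] at this ⊢
    linarith
  simpa [mollifier] using this

theorem mollify_apply (j : ℕ) (f : Rn n → ℝ) (x : Rn n) :
    mollify j f x = ∫ z, mollifier n j (x - z) * f z := by
  rw [mollify, convolution_lsmul_swap]; rfl

theorem isTestFunction_mollifier_sub (j : ℕ) (x : Rn n) :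
    IsTestFunction (fun z => mollifier n j (x - z)) :=
  ⟨(isTestFunction_mollifier n j).1.comp (contDiff_const.sub contDiff_id),
    (isTestFunction_mollifier n j).2.comp_homeomorph (Homeomorph.subLeft x)⟩

theorem integral_mollifier_sub (j : ℕ) (x : Rn n) : ∫ z, mollifier n j (x - z) = 1 := by
  rw [integral_sub_left_eq_self (mollifier n j) volume x]
  exact (shrinkingBump n j).integral_normed

theorem integrable_mul_test {f η : Rn n → ℝ} (hf : LocallyIntegrable f) (hη : IsTestFunction η) :
    Integrable (fun x => f x * η x) := by
  simpa [mul_comm] using hf.integrable_smul_left_of_hasCompactSupport hη.continuous hη.2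

theorem integrable_mollify (j : ℕ) {f : Rn n → ℝ} (hf : LocallyIntegrable f) (x : Rn n) :
    Integrable (fun z => mollifier n j (x - z) * f z) := by
  simpa [mul_comm] using integrable_mul_test hf (isTestFunction_mollifier_sub j x)

theorem contDiff_mollify (j : ℕ) {f : Rn n → ℝ} (hf : LocallyIntegrable f) :
    ContDiff ℝ ∞ (mollify j f) :=
  HasCompactSupport.contDiff_convolution_left _ (isTestFunction_mollifier n j).2
    (isTestFunction_mollifier n j).1 hf

theorem contDiff_two_mollify (j : ℕ) {f : Rn n → ℝ} (hf : LocallyIntegrable f) :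
    ContDiff ℝ 2 (mollify j f) := contDiff_infty.1 (contDiff_mollify j hf) 2

theorem mollify_mono (j : ℕ) {f g : Rn n → ℝ} (hf : LocallyIntegrable f)
    (hg : LocallyIntegrable g) (h : ∀ x, f x ≤ g x) (x : Rn n) : mollify j f x ≤ mollify j g x := by
  rw [mollify_apply, mollify_apply]
  exact integral_mono (integrable_mollify j hf x) (integrable_mollify j hg x)
    fun z => mul_le_mul_of_nonneg_left (h z) (mollifier_nonneg j _)

theorem mollify_nonneg (j : ℕ) {f : Rn n → ℝ} (h : ∀ x, 0 ≤ f x) (x : Rn n) :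
    0 ≤ mollify j f x := by
  rw [mollify_apply]
  exact integral_nonneg fun z => mul_nonneg (mollifier_nonneg j _) (h z)

theorem mollify_const_mul (j : ℕ) (c : ℝ) (f : Rn n → ℝ) (x : Rn n) :
    mollify j (fun z => c * f z) x = c * mollify j f x := by
  rw [mollify_apply, mollify_apply, ← integral_const_mul]
  congr 1; ext z; ring

theorem mollify_sum {ι : Type*} (s : Finset ι) (j : ℕ) {f : ι → Rn n → ℝ}
    (hf : ∀ i, LocallyIntegrable (f i)) (x : Rn n) :
    mollify j (fun z => ∑ i ∈ s, f i z) x = ∑ i ∈ s, mollify j (f i) x := by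
  simp only [mollify_apply, Finset.mul_sum]
  exact integral_finsetSum _ fun i _ => integrable_mollify j (hf i) x

theorem abs_mollify_le (j : ℕ) {f g : Rn n → ℝ} (hf : LocallyIntegrable f)
    (hg : LocallyIntegrable g) (h : ∀ x, |f x| ≤ g x) (x : Rn n) :
    |mollify j f x| ≤ mollify j g x := by
  rw [abs_le]
  constructor
  · have := mollify_mono j (f := fun z => (-1) * g z) (hg.smul (-1 : ℝ)) hf
      (fun x => by simpa using (abs_le.1 (h x)).1) x
    rw [mollify_const_mul] at this
    linarith
  · exact mollify_mono j hf hg (fun x => (abs_le.1 (h x)).2) x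

theorem le_mollify (j : ℕ) {f : Rn n → ℝ} (hf : LocallyIntegrable f) {c : ℝ} {x : Rn n}
    (h : ∀ z, dist z x < 1 → c ≤ f z) : c ≤ mollify j f x := by
  have hρ := isTestFunction_mollifier_sub j x
  have h1 : ∫ z, mollifier n j (x - z) * c ≤ mollify j f x := by
    rw [mollify_apply]
    refine integral_mono ((hρ.continuous.integrable_of_hasCompactSupport hρ.2).mul_const c)
      (integrable_mollify j hf x) fun z => ?_
    by_cases hz : dist z x < 1
    · exact mul_le_mul_of_nonneg_left (h z hz) (mollifier_nonneg j _)
    · have : mollifier n j (x - z) = 0 :=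
        mollifier_eq_zero (by rwa [← dist_eq_norm, dist_comm, ← not_lt])
      simp [this]
  rwa [integral_mul_const, integral_mollifier_sub, one_mul] at h1

theorem tendsto_shrinkingBump_rOut (n : ℕ) :
    Tendsto (fun j => (shrinkingBump n j).rOut) atTop (𝓝 0) :=
  tendsto_one_div_add_atTop_nhds_zero_nat

theorem ae_tendsto_mollify {f : Rn n → ℝ} (hf : LocallyIntegrable f) :
    ∀ᵐ x, Tendsto (fun j => mollify j f x) atTop (𝓝 (f x)) :=
  ContDiffBump.ae_convolution_tendsto_right_of_locallyIntegrable (K := 2)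
    (tendsto_shrinkingBump_rOut n)
    (Eventually.of_forall fun j => by simp [shrinkingBump]; linarith) hf

theorem tendsto_mollify_of_continuous {f : Rn n → ℝ} (hf : Continuous f) {k : ℕ → Rn n}
    {x : Rn n} (hk : Tendsto k atTop (𝓝 x)) :
    Tendsto (fun j => mollify j f (k j)) atTop (𝓝 (f x)) :=
  ContDiffBump.convolution_tendsto_right (g := fun _ => f) (tendsto_shrinkingBump_rOut n)
    (Eventually.of_forall fun _ => hf.aestronglyMeasurable)
    ((hf.tendsto x).comp tendsto_snd) hk

theorem secondDiff_mollify (j : ℕ) {f : Rn n → ℝ} (hf : LocallyIntegrable f) (x y : Rn n) :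
    secondDiff (mollify j f) x y
      = ∫ z, f z * secondDiff (fun z => mollifier n j (x - z)) z y := by
  have h := integral_two_mul_sub_sub (integrable_mollify j hf x) (integrable_mollify j hf (x + y))
    (integrable_mollify j hf (x - y))
  simp only [secondDiff, mollify_apply]
  rw [← h]
  congr 1; ext z
  rw [show x - (z + y) = x - y - z by abel, show x - (z - y) = x + y - z by abel]
  ring

/-- The weak equation is tested with a translate of the reflected mollifier. This turns a merely
locally integrable solution into a smooth function with a pointwise equation, without any regularity
theory. -/
theorem IsWeakSolution.nonlocalOp_mollify {K f F : Rn n → ℝ} (hA : KernelCondition K)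
    (h : IsWeakSolution K f F) (j : ℕ) (x : Rn n) :
    nonlocalOp K (mollify j f) x = mollify j F x := by
  have hη := isTestFunction_mollifier_sub j x
  have h1 := h.eq _ hη
  rw [integral_mul_nonlocalOp, integral_integral_swap
    (f := fun z y => f z * (secondDiff (fun z => mollifier n j (x - z)) z y * K y))
      (hA.integrable_prod_mul_secondDiff h.left hη)] at h1
  rw [mollify_apply, nonlocalOp_eq_secondDiff]
  simp only [mul_comm (mollifier n j _)]
  rw [← h1]
  congr 2; ext y
  rw [secondDiff_mollify j h.left, ← integral_mul_const]
  congr 1; ext z; ring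

end Mollify

/-! ### Minimisation over a dense class -/

section Minimisation

open scoped InnerProductSpace

/-- Minimising the quadratic functional `½⟪ι ζ, G ζ⟫ - ⟪b, ι ζ⟫` over a set `P` that contains almost
minimisers yields a weak solution in the closure of `P`. -/
theorem exists_weak_minimizer {T E : Type*} [AddCommGroup T] [Module ℝ T] [NormedAddCommGroup E]
    [InnerProductSpace ℝ E] [CompleteSpace E] (ι G : T →ₗ[ℝ] E)
    (hsymm : ∀ ζ η, ⟪ι ζ, G η⟫_ℝ = ⟪ι η, G ζ⟫_ℝ) {μ : ℝ} (hμ : 0 < μ)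
    (hpos : ∀ ζ, μ * ‖ι ζ‖ ^ 2 ≤ ⟪ι ζ, G ζ⟫_ℝ) (b : E) (P : Set T)
    (hP : ∀ ζ, ∀ ε > 0, ∃ ζ' ∈ P, (1 / 2) * ⟪ι ζ', G ζ'⟫_ℝ - ⟪b, ι ζ'⟫_ℝ
      ≤ (1 / 2) * ⟪ι ζ, G ζ⟫_ℝ - ⟪b, ι ζ⟫_ℝ + ε) :
    ∃ u ∈ closure (ι '' P), ∀ η, ⟪u, G η⟫_ℝ = ⟪b, ι η⟫_ℝ := by
  set J : T → ℝ := fun ζ => (1 / 2) * ⟪ι ζ, G ζ⟫_ℝ - ⟪b, ι ζ⟫_ℝ with hJ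
  have hbdd : ∀ ζ, -(‖b‖ ^ 2 / (2 * μ)) ≤ J ζ := by
    intro ζ
    have h1 := hpos ζ
    have h2 := real_inner_le_norm b (ι ζ)
    have h3 : 0 ≤ (μ * ‖ι ζ‖ - ‖b‖) ^ 2 / (2 * μ) := by positivity
    have h4 : (μ * ‖ι ζ‖ - ‖b‖) ^ 2 / (2 * μ)
        = (1 / 2) * (μ * ‖ι ζ‖ ^ 2) - ‖b‖ * ‖ι ζ‖ + ‖b‖ ^ 2 / (2 * μ) := by
      field_simp; ring
    simp only [hJ]; linarith
  set m := sInf (Set.range J) with hm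
  have hBB : BddBelow (Set.range J) := ⟨_, by rintro _ ⟨ζ, rfl⟩; exact hbdd ζ⟩
  have hmle : ∀ ζ, m ≤ J ζ := fun ζ => csInf_le hBB ⟨ζ, rfl⟩
  have hseq : ∀ k : ℕ, ∃ ζ ∈ P, J ζ ≤ m + 1 / (k + 1) := by
    intro k
    have hk : (0 : ℝ) < 1 / (k + 1) / 2 := by positivity
    obtain ⟨_, ⟨ζ, rfl⟩, h1⟩ := exists_lt_of_csInf_lt (Set.range_nonempty J)
      (lt_add_of_pos_right m hk)
    obtain ⟨ζ', h2, h3⟩ := hP ζ _ hk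
    exact ⟨ζ', h2, by simp only [hJ] at h1 ⊢; linarith⟩
  choose ζ hζP hζ using hseq
  -- Exact expansion of the quadratic functional along a line; it serves both for the midpoint
  -- estimate and for the Euler–Lagrange equation.
  have hexp : ∀ (a c : T) (t : ℝ), J (a + t • c)
      = J a + t * (⟪ι a, G c⟫_ℝ - ⟪b, ι c⟫_ℝ) + t ^ 2 * ((1 / 2) * ⟪ι c, G c⟫_ℝ) := by
    intro a c t
    simp only [hJ, map_add, map_smul, inner_add_left, inner_add_right, real_inner_smul_left,
      real_inner_smul_right, hsymm c a]
    ring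
  -- Parallelogram argument: J at the midpoint is at least m, and coercivity bounds the convexity
  -- defect from below. Hence minimising sequences are Cauchy.
  have hmid : ∀ a c : T, μ * ‖ι a - ι c‖ ^ 2 ≤ 4 * (J a + J c - 2 * m) := by
    intro a c
    have h1 := hpos (a - c)
    have h2 := hmle (c + (1 / 2 : ℝ) • (a - c))
    have h3 : J a = J (c + (1 : ℝ) • (a - c)) := by simp
    rw [hexp] at h2 h3
    rw [← map_sub]
    linarith
  have hcau : CauchySeq (fun k => ι (ζ k)) := by
    refine cauchySeq_of_le_tendsto_0 (fun N : ℕ => √(8 / μ * (1 / (N + 1)))) ?_ ?_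
    · intro k l N hk hl
      refine Real.le_sqrt_of_sq_le ?_
      have h1 := hmid (ζ k) (ζ l)
      have h2 : (1 : ℝ) / (k + 1) ≤ 1 / (N + 1) := by gcongr
      have h3 : (1 : ℝ) / (l + 1) ≤ 1 / (N + 1) := by gcongr
      have h4 := hζ k
      have h5 := hζ l
      rw [dist_eq_norm, div_mul_eq_mul_div, le_div_iff₀ hμ]
      linarith
    · have h1 : Tendsto (fun N : ℕ => √(8 / μ * (1 / ((N : ℝ) + 1)))) atTop (𝓝 (√(8 / μ * 0))) :=
        (Real.continuous_sqrt.tendsto _).comp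
          (tendsto_one_div_add_atTop_nhds_zero_nat.const_mul (8 / μ))
      simpa using h1
  obtain ⟨u, hu⟩ := cauchySeq_tendsto_of_complete hcau
  refine ⟨u, mem_closure_of_tendsto hu (Eventually.of_forall fun k => ⟨_, hζP k, rfl⟩), fun η => ?_⟩
  set d := ⟪u, G η⟫_ℝ - ⟪b, ι η⟫_ℝ with hd
  set q := (1 / 2) * ⟪ι η, G η⟫_ℝ with hq
  have hq0 : 0 ≤ q := by
    have := hpos η
    have h2 : 0 ≤ μ * ‖ι η‖ ^ 2 := by positivity
    simp only [hq]; linarith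
  -- By symmetry the linear term sees the approximants only through their images under ι paired with
  -- the fixed vector G η, so it passes to the limit although G need not be closed.
  have key : ∀ t : ℝ, 0 ≤ t * d + t ^ 2 * q := by
    intro t
    have h1 : Tendsto (fun k : ℕ => 1 / ((k : ℝ) + 1) + t * (⟪ι (ζ k), G η⟫_ℝ - ⟪b, ι η⟫_ℝ)
        + t ^ 2 * q) atTop (𝓝 (0 + t * d + t ^ 2 * q)) :=
      (tendsto_one_div_add_atTop_nhds_zero_nat.add
        (((hu.inner tendsto_const_nhds).sub_const _).const_mul t)).add_const _
    have h2 : 0 ≤ 0 + t * d + t ^ 2 * q := by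
      refine ge_of_tendsto' h1 fun k => ?_
      have h3 := hmle (ζ k + t • η)
      rw [hexp, ← hq] at h3
      have h4 := hζ k
      linarith
    linarith
  -- This t makes the expression equal to −d²/(q + 1)²; the added 1 covers q = 0.
  have h1 := key (-d / (q + 1))
  have h2 : -d / (q + 1) * d + (-d / (q + 1)) ^ 2 * q = -(d ^ 2 / (q + 1) ^ 2) := by
    field_simp
    ring_nf
  rw [h2] at h1
  have h3 : d ^ 2 / (q + 1) ^ 2 ≤ 0 := by linarith
  have h4 : d ^ 2 ≤ 0 := by
    rw [div_le_iff₀ (by positivity)] at h3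
    linarith
  have h5 : d = 0 := by nlinarith [sq_nonneg d]
  linarith

end Minimisation

/-! ### Smoothed absolute values -/

/-- A smooth contraction approximating the absolute value. -/
noncomputable def smoothAbs (δ t : ℝ) : ℝ := √(t ^ 2 + δ ^ 2) - δ

theorem contDiff_smoothAbs {δ : ℝ} (hδ : 0 < δ) : ContDiff ℝ ∞ (smoothAbs δ) := by
  unfold smoothAbs
  refine ContDiff.sub (ContDiff.sqrt (by fun_prop) fun t => ?_) contDiff_const
  positivity

theorem smoothAbs_zero {δ : ℝ} (hδ : 0 ≤ δ) : smoothAbs δ 0 = 0 := by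
  simp [smoothAbs, Real.sqrt_sq hδ]

theorem smoothAbs_nonneg {δ : ℝ} (t : ℝ) : 0 ≤ smoothAbs δ t := by
  rw [smoothAbs, sub_nonneg]
  exact Real.le_sqrt_of_sq_le (by nlinarith [sq_nonneg t])

theorem smoothAbs_le {δ : ℝ} (hδ : 0 ≤ δ) (t : ℝ) : smoothAbs δ t ≤ |t| := by
  rw [smoothAbs, sub_le_iff_le_add]
  refine Real.sqrt_le_iff.2 ⟨by positivity, ?_⟩
  nlinarith [sq_abs t, abs_nonneg t, mul_nonneg (abs_nonneg t) hδ]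

/-- √(t² + δ²) is the Euclidean norm of (t, δ), so this is the reverse triangle inequality. It is
what keeps the energy from increasing under composition. -/
theorem abs_smoothAbs_sub_le (δ s t : ℝ) : |smoothAbs δ s - smoothAbs δ t| ≤ |s - t| := by
  have key : ∀ a b : ℝ, √(a ^ 2 + δ ^ 2) ≤ √(b ^ 2 + δ ^ 2) + |a - b| := by
    intro a b
    refine Real.sqrt_le_iff.2 ⟨by positivity, ?_⟩
    have h1 : √(b ^ 2 + δ ^ 2) ^ 2 = b ^ 2 + δ ^ 2 := Real.sq_sqrt (by positivity)
    have h2 : |b| ≤ √(b ^ 2 + δ ^ 2) := Real.abs_le_sqrt (by nlinarith [sq_nonneg δ])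
    have h3 : b * (a - b) ≤ √(b ^ 2 + δ ^ 2) * |a - b| :=
      (le_abs_self _).trans ((abs_mul _ _).le.trans
        (mul_le_mul_of_nonneg_right h2 (abs_nonneg _)))
    nlinarith [sq_abs (a - b)]
  have h1 := key s t
  have h2 := key t s
  rw [abs_sub_comm t s] at h2
  unfold smoothAbs
  rw [abs_le]
  constructor <;> linarith

theorem tendsto_smoothAbs (t : ℝ) :
    Tendsto (fun k : ℕ => smoothAbs (1 / ((k : ℝ) + 1)) t) atTop (𝓝 |t|) := by
  have h1 : Continuous (fun δ => smoothAbs δ t) := by unfold smoothAbs; fun_prop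
  have h2 := (h1.tendsto 0).comp tendsto_one_div_add_atTop_nhds_zero_nat
  have e : smoothAbs 0 t = |t| := by simp [smoothAbs, Real.sqrt_sq_eq_abs]
  rw [e] at h2
  exact h2

theorem IsTestFunction.smoothAbs_comp {n : ℕ} {ζ : Rn n → ℝ} (h : IsTestFunction ζ) {δ : ℝ}
    (hδ : 0 < δ) : IsTestFunction (fun x => smoothAbs δ (ζ x)) :=
  ⟨(contDiff_smoothAbs hδ).comp h.1, h.2.comp_left (smoothAbs_zero hδ.le)⟩

/-! ### Cooperative systems and their resolvent -/

/-- A bounded measurable symmetric coefficient matrix with positive off-diagonal entries whose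
quadratic form is controlled by the energy. -/
structure IsStableCooperative {n m : ℕ} (K : Rn n → ℝ) (B : ℝ)
    (A : Rn n → Matrix (Fin m) (Fin m) ℝ) : Prop where
  measurable : ∀ i j, Measurable fun x => A x i j
  bound : ∀ x i j, |A x i j| ≤ B
  symm : ∀ x i j, A x i j = A x j i
  pos : ∀ x i j, i ≠ j → 0 < A x i j
  stable : ∀ ζ : Fin m → Rn n → ℝ, (∀ i, IsTestFunction (ζ i)) →
    ∑ i, ∑ j, ∫ x, A x i j * ζ i x * ζ j x ≤ ∑ i, ∫ x, ζ i x * nonlocalOp K (ζ i) x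

section Resolvent

variable {n m : ℕ} {K : Rn n → ℝ} {B μ : ℝ} {A : Rn n → Matrix (Fin m) (Fin m) ℝ}

open scoped InnerProductSpace

theorem memLp_two_of_bounded_support {f : Rn n → ℝ} (hf : Measurable f) {C R : ℝ}
    (hb : ∀ x, |f x| ≤ C) (hz : ∀ x, R < ‖x‖ → f x = 0) : MemLp f 2 := by
  have h1 : MemLp ((Metric.closedBall (0 : Rn n) R).indicator fun _ => C) 2 :=
    memLp_indicator_const 2 measurableSet_closedBall C
      (Or.inr (isCompact_closedBall _ _).measure_lt_top.ne)
  refine h1.mono hf.aestronglyMeasurable (Eventually.of_forall fun x => ?_)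
  by_cases hx : ‖x‖ ≤ R
  · rw [Set.indicator_of_mem (by simpa using hx)]
    exact (hb x).trans (le_abs_self C)
  · rw [hz x (not_le.1 hx)]; simp

theorem IsTestFunction.memLp {η : Rn n → ℝ} (h : IsTestFunction η) : MemLp η 2 :=
  h.continuous.memLp_of_hasCompactSupport h.2

theorem KernelCondition.exists_bound_support (hA : KernelCondition K) {η : Rn n → ℝ}
    (h : IsTestFunction η) :
    ∃ C R, (∀ x, |nonlocalOp K η x| ≤ C) ∧ ∀ x, R < ‖x‖ → nonlocalOp K η x = 0 := by
  obtain ⟨C, R, hC, hR, hz, hb⟩ := h.exists_abs_secondDiff_le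
  have h1 : ∀ x, |nonlocalOp K η x|
      ≤ (Metric.closedBall (0 : Rn n) R).indicator (fun _ => C) x * ∫ y, ‖y‖ ^ 2 * K y :=
    fun x => hA.abs_nonlocalOp_le (hb x)
  refine ⟨C * ∫ y, ‖y‖ ^ 2 * K y, R, fun x => (h1 x).trans ?_, fun x hx => ?_⟩
  · exact mul_le_mul_of_nonneg_right (Set.indicator_le_self' (fun _ _ => hC) x) hA.moment_nonneg
  · have := h1 x
    rw [Set.indicator_of_notMem (by simpa using hx)] at this
    exact abs_eq_zero.1 (le_antisymm (by simpa using this) (abs_nonneg _))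

theorem KernelCondition.memLp_nonlocalOp (hA : KernelCondition K) {η : Rn n → ℝ}
    (h : IsTestFunction η) : MemLp (nonlocalOp K η) 2 := by
  obtain ⟨C, R, hb, hz⟩ := hA.exists_bound_support h
  exact memLp_two_of_bounded_support (hA.measurable_nonlocalOp h.continuous) hb hz

theorem MemLp.bounded_mul {f a : Rn n → ℝ} (hf : MemLp f 2) (ha : Measurable a)
    (hb : ∀ x, |a x| ≤ B) : MemLp (fun x => a x * f x) 2 :=
  MemLp.of_le_mul (c := B) hf (ha.aestronglyMeasurable.mul hf.aestronglyMeasurable)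
    (Eventually.of_forall fun x => by
      rw [norm_mul]; exact mul_le_mul_of_nonneg_right (hb x) (norm_nonneg _))

/-- Tuples of test functions. -/
def testTuples (n m : ℕ) : Submodule ℝ (Fin m → Rn n → ℝ) where
  carrier := {ζ | ∀ i, IsTestFunction (ζ i)}
  add_mem' ha hb i := ⟨(ha i).1.add (hb i).1, (ha i).2.add (hb i).2⟩
  zero_mem' _ := ⟨contDiff_const, HasCompactSupport.zero⟩
  smul_mem' c _ ha i := ⟨(ha i).1.const_smul c, (ha i).2.smul_left (f := fun _ => c)⟩

/-- The operator `L - A + μ` applied to a tuple. -/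
noncomputable def systemOp (K : Rn n → ℝ) (A : Rn n → Matrix (Fin m) (Fin m) ℝ) (μ : ℝ)
    (ζ : Fin m → Rn n → ℝ) (i : Fin m) (x : Rn n) : ℝ :=
  nonlocalOp K (ζ i) x - ∑ j, A x i j * ζ j x + μ * ζ i x

theorem memLp_systemOp (hK : KernelCondition K) (hS : IsStableCooperative K B A)
    {ζ : Fin m → Rn n → ℝ} (hζ : ∀ i, IsTestFunction (ζ i)) (i : Fin m) :
    MemLp (systemOp K A μ ζ i) 2 := by
  refine ((hK.memLp_nonlocalOp (hζ i)).sub (memLp_finsetSum _ fun j _ => ?_)).add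
    ((hζ i).memLp.const_mul μ)
  exact MemLp.bounded_mul (hζ j).memLp (hS.measurable i j) fun x => hS.bound x i j

/-- Tuples of square integrable functions. -/
abbrev L2Tuples (n m : ℕ) : Type := PiLp 2 fun _ : Fin m => Lp ℝ 2 (volume : Measure (Rn n))

/-- The class of a tuple of square integrable functions. -/
noncomputable def toL2Tuple (f : Fin m → Rn n → ℝ) (hf : ∀ i, MemLp (f i) 2) : L2Tuples n m :=
  WithLp.toLp 2 fun i => (hf i).toLp (f i)

theorem inner_toL2Tuple (u : L2Tuples n m) {f : Fin m → Rn n → ℝ} (hf : ∀ i, MemLp (f i) 2) :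
    ⟪u, toL2Tuple f hf⟫_ℝ = ∑ i, ∫ x, u i x * f i x := by
  rw [PiLp.inner_apply]
  refine Finset.sum_congr rfl fun i _ => ?_
  rw [L2.inner_def]
  refine integral_congr_ae ?_
  filter_upwards [(hf i).coeFn_toLp] with x hx
  simp only [toL2Tuple, hx, RCLike.inner_apply, conj_trivial]
  ring

theorem inner_toL2Tuple_toL2Tuple {f g : Fin m → Rn n → ℝ} (hf : ∀ i, MemLp (f i) 2)
    (hg : ∀ i, MemLp (g i) 2) :
    ⟪toL2Tuple f hf, toL2Tuple g hg⟫_ℝ = ∑ i, ∫ x, f i x * g i x := by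
  rw [inner_toL2Tuple]
  refine Finset.sum_congr rfl fun i _ => integral_congr_ae ?_
  filter_upwards [(hf i).coeFn_toLp] with x hx
  simp only [toL2Tuple, hx]

theorem toL2Tuple_add {f g : Fin m → Rn n → ℝ} (hf : ∀ i, MemLp (f i) 2)
    (hg : ∀ i, MemLp (g i) 2) (hfg : ∀ i, MemLp ((f + g) i) 2) :
    toL2Tuple (f + g) hfg = toL2Tuple f hf + toL2Tuple g hg := rfl

theorem toL2Tuple_smul (c : ℝ) {f : Fin m → Rn n → ℝ} (hf : ∀ i, MemLp (f i) 2)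
    (hcf : ∀ i, MemLp ((c • f) i) 2) :
    toL2Tuple (c • f) hcf = c • toL2Tuple f hf := rfl

theorem systemOp_add (hK : KernelCondition K) {ζ η : Fin m → Rn n → ℝ}
    (hζ : ∀ i, ContDiff ℝ 2 (ζ i)) (hη : ∀ i, ContDiff ℝ 2 (η i)) :
    systemOp K A μ (ζ + η) = systemOp K A μ ζ + systemOp K A μ η := by
  ext i x
  have h := hK.nonlocalOp_add (hζ i) (hη i) x
  change nonlocalOp K (fun z => ζ i z + η i z) x - ∑ j, A x i j * (ζ j x + η j x)
    + μ * (ζ i x + η i x) = (nonlocalOp K (ζ i) x - ∑ j, A x i j * ζ j x + μ * ζ i x)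
    + (nonlocalOp K (η i) x - ∑ j, A x i j * η j x + μ * η i x)
  simp only [h, mul_add, Finset.sum_add_distrib]
  ring

theorem systemOp_smul (c : ℝ) (ζ : Fin m → Rn n → ℝ) :
    systemOp K A μ (c • ζ) = c • systemOp K A μ ζ := by
  ext i x
  have h := nonlocalOp_const_mul K c (ζ i) x
  change nonlocalOp K (fun z => c * ζ i z) x - ∑ j, A x i j * (c * ζ j x)
    + μ * (c * ζ i x) = c * (nonlocalOp K (ζ i) x - ∑ j, A x i j * ζ j x + μ * ζ i x)
  simp only [h, mul_add, mul_sub, Finset.mul_sum]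
  congr 1
  · congr 1
    exact Finset.sum_congr rfl fun j _ => by ring
  · ring

theorem isTestFunction_coe (ζ : testTuples n m) : ∀ i, IsTestFunction (ζ.1 i) := ζ.2

/-- The inclusion of test tuples into `L²`. -/
noncomputable def testToL2 (n m : ℕ) : testTuples n m →ₗ[ℝ] L2Tuples n m where
  toFun ζ := toL2Tuple ζ.1 fun i => ((isTestFunction_coe ζ) i).memLp
  map_add' _ _ := rfl
  map_smul' _ _ := rfl

/-- The operator `L - A + μ` from test tuples to `L²`. -/
noncomputable def systemToL2 (hK : KernelCondition K) (hS : IsStableCooperative K B A) (μ : ℝ) :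
    testTuples n m →ₗ[ℝ] L2Tuples n m where
  toFun ζ := toL2Tuple (systemOp K A μ ζ.1) fun i => memLp_systemOp hK hS (isTestFunction_coe ζ) i
  map_add' ζ η := by
    rw [← toL2Tuple_add (hfg := fun i => by
      rw [← systemOp_add hK (fun i => ((isTestFunction_coe ζ) i).contDiff_two) fun i => ((isTestFunction_coe η) i).contDiff_two]
      exact memLp_systemOp hK hS (isTestFunction_coe (ζ + η)) i)]
    congr 1
    exact systemOp_add hK (fun i => ((isTestFunction_coe ζ) i).contDiff_two) fun i => ((isTestFunction_coe η) i).contDiff_two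
  map_smul' c ζ := by
    rw [RingHom.id_apply, ← toL2Tuple_smul (hcf := fun i => by
      rw [← systemOp_smul]; exact memLp_systemOp hK hS (isTestFunction_coe (c • ζ)) i)]
    congr 1
    exact systemOp_smul c ζ.1

theorem integrable_coeff_mul (hS : IsStableCooperative K B A) {f g : Rn n → ℝ} (hf : MemLp f 2)
    (hg : MemLp g 2) (i j : Fin m) : Integrable fun x => A x i j * f x * g x :=
  MemLp.integrable_mul (MemLp.bounded_mul hf (hS.measurable i j) fun x => hS.bound x i j) hg

theorem inner_testToL2_systemToL2 (hK : KernelCondition K) (hS : IsStableCooperative K B A)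
    (ζ η : testTuples n m) :
    ⟪testToL2 n m ζ, systemToL2 hK hS μ η⟫_ℝ
      = (∑ i, ∫ x, ζ.1 i x * nonlocalOp K (η.1 i) x)
        - (∑ i, ∑ j, ∫ x, A x i j * ζ.1 i x * η.1 j x) + μ * ∑ i, ∫ x, ζ.1 i x * η.1 i x := by
  refine (inner_toL2Tuple_toL2Tuple _ _).trans ?_
  rw [Finset.mul_sum, ← Finset.sum_sub_distrib, ← Finset.sum_add_distrib]
  refine Finset.sum_congr rfl fun i _ => ?_
  have hz := ((isTestFunction_coe ζ) i).memLp
  have i1 : Integrable (fun x => ζ.1 i x * nonlocalOp K (η.1 i) x) :=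
    hz.integrable_mul (hK.memLp_nonlocalOp ((isTestFunction_coe η) i))
  have i2 : ∀ j ∈ Finset.univ, Integrable (fun x => A x i j * ζ.1 i x * η.1 j x) := fun j _ =>
    integrable_coeff_mul hS hz ((isTestFunction_coe η) j).memLp i j
  have i3 : Integrable (fun x => ζ.1 i x * η.1 i x) := hz.integrable_mul ((isTestFunction_coe η) i).memLp
  have i4 : Integrable (fun x => ζ.1 i x * nonlocalOp K (η.1 i) x
      - ∑ j, A x i j * ζ.1 i x * η.1 j x) := i1.sub (integrable_finsetSum _ i2)
  rw [← integral_finsetSum _ i2, ← integral_const_mul, ← integral_sub i1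
    (integrable_finsetSum _ i2), ← integral_add i4 (i3.const_mul μ)]
  congr 1; ext x
  simp only [systemOp, mul_add, mul_sub, Finset.mul_sum]
  congr 1
  · congr 1
    exact Finset.sum_congr rfl fun j _ => by ring
  · ring

theorem inner_testToL2_systemToL2_comm (hK : KernelCondition K) (hS : IsStableCooperative K B A)
    (ζ η : testTuples n m) :
    ⟪testToL2 n m ζ, systemToL2 hK hS μ η⟫_ℝ = ⟪testToL2 n m η, systemToL2 hK hS μ ζ⟫_ℝ := by
  rw [inner_testToL2_systemToL2, inner_testToL2_systemToL2]
  congr 1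
  · congr 1
    · refine Finset.sum_congr rfl fun i _ => ?_
      rw [hK.integral_mul_nonlocalOp_comm ((isTestFunction_coe ζ) i).contDiff_two ((isTestFunction_coe η) i)]
      simp only [mul_comm]
    · rw [Finset.sum_comm]
      refine Finset.sum_congr rfl fun i _ => Finset.sum_congr rfl fun j _ => ?_
      congr 1; ext x
      rw [hS.symm x j i]; ring
  · simp only [mul_comm]

theorem norm_testToL2_sq (ζ : testTuples n m) :
    ‖testToL2 n m ζ‖ ^ 2 = ∑ i, ∫ x, ζ.1 i x * ζ.1 i x := by
  rw [← real_inner_self_eq_norm_sq]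
  exact inner_toL2Tuple_toL2Tuple _ _

/-- Stability says that L − A is a nonnegative form on test tuples, so adding μ makes it coercive in
L². -/
theorem mul_norm_sq_le_inner_systemToL2 (hK : KernelCondition K) (hS : IsStableCooperative K B A)
    (ζ : testTuples n m) :
    μ * ‖testToL2 n m ζ‖ ^ 2 ≤ ⟪testToL2 n m ζ, systemToL2 hK hS μ ζ⟫_ℝ := by
  rw [inner_testToL2_systemToL2, norm_testToL2_sq]
  linarith [hS.stable ζ.1 (isTestFunction_coe ζ)]

theorem tendsto_integral_mul_smoothAbs {a : Rn n → ℝ} (ha : Measurable a) (hb : ∀ x, |a x| ≤ B)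
    {f g : Rn n → ℝ} (hf : IsTestFunction f) (hg : IsTestFunction g) :
    Tendsto (fun k : ℕ => ∫ x, a x * smoothAbs (1 / ((k : ℝ) + 1)) (f x)
      * smoothAbs (1 / ((k : ℝ) + 1)) (g x)) atTop (𝓝 (∫ x, a x * |f x| * |g x|)) := by
  refine tendsto_integral_of_dominated_convergence (fun x => ‖a x * f x * g x‖) (fun k => ?_)
    (MemLp.integrable_mul (MemLp.bounded_mul hf.memLp ha hb) hg.memLp).norm (fun k => ?_) ?_
  · have hk : (0 : ℝ) < 1 / ((k : ℝ) + 1) := by positivity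
    exact ((ha.mul (hf.smoothAbs_comp hk).continuous.measurable).mul
      (hg.smoothAbs_comp hk).continuous.measurable).aestronglyMeasurable
  · refine Eventually.of_forall fun x => ?_
    have hk : (0 : ℝ) ≤ 1 / ((k : ℝ) + 1) := by positivity
    simp only [norm_mul, Real.norm_eq_abs, abs_of_nonneg (smoothAbs_nonneg _)]
    have h1 := smoothAbs_le hk (f x)
    have h2 := smoothAbs_le hk (g x)
    have h3 := smoothAbs_nonneg (δ := 1 / ((k : ℝ) + 1)) (g x)
    gcongr
  · exact Eventually.of_forall fun x =>
      (tendsto_const_nhds.mul (tendsto_smoothAbs _)).mul (tendsto_smoothAbs _)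

theorem tendsto_integral_mul_smoothAbs_left {b f : Rn n → ℝ} (hb : MemLp b 2)
    (hf : IsTestFunction f) :
    Tendsto (fun k : ℕ => ∫ x, b x * smoothAbs (1 / ((k : ℝ) + 1)) (f x)) atTop
      (𝓝 (∫ x, b x * |f x|)) := by
  refine tendsto_integral_of_dominated_convergence (fun x => ‖b x * f x‖) (fun k => ?_)
    (hb.integrable_mul hf.memLp).norm (fun k => ?_) ?_
  · have hk : (0 : ℝ) < 1 / ((k : ℝ) + 1) := by positivity
    exact hb.aestronglyMeasurable.mul (hf.smoothAbs_comp hk).continuous.aestronglyMeasurable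
  · refine Eventually.of_forall fun x => ?_
    have hk : (0 : ℝ) ≤ 1 / ((k : ℝ) + 1) := by positivity
    simp only [norm_mul, Real.norm_eq_abs, abs_of_nonneg (smoothAbs_nonneg _)]
    exact mul_le_mul_of_nonneg_left (smoothAbs_le hk (f x)) (abs_nonneg _)
  · exact Eventually.of_forall fun x => tendsto_const_nhds.mul (tendsto_smoothAbs _)

end Resolvent

/-! ### Nonnegative almost minimisers and the resolvent -/

section Resolvent

variable {n m : ℕ} {K : Rn n → ℝ} {B μ : ℝ} {A : Rn n → Matrix (Fin m) (Fin m) ℝ}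

open scoped InnerProductSpace

/-- The candidate is ζ with a smoothed absolute value applied to each component. The energy does not
increase, the diagonal terms and the L² norm depend only on |ζ_i| in the limit, and the off-diagonal
and source terms favour |ζ| because A_ij > 0 and b ≥ 0. The loss ε pays for smoothing. -/
theorem exists_nonneg_almost_minimizer (hK : KernelCondition K) (hS : IsStableCooperative K B A)
    {b : Fin m → Rn n → ℝ} (hb : ∀ i, MemLp (b i) 2) (hb0 : ∀ i x, 0 ≤ b i x)
    (ζ : testTuples n m) {ε : ℝ} (hε : 0 < ε) :
    ∃ ζ' ∈ {ζ : testTuples n m | ∀ i x, 0 ≤ ζ.1 i x},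
      (1 / 2) * ⟪testToL2 n m ζ', systemToL2 hK hS μ ζ'⟫_ℝ - ⟪toL2Tuple b hb, testToL2 n m ζ'⟫_ℝ
      ≤ (1 / 2) * ⟪testToL2 n m ζ, systemToL2 hK hS μ ζ⟫_ℝ - ⟪toL2Tuple b hb, testToL2 n m ζ⟫_ℝ
        + ε := by
  have ht := isTestFunction_coe ζ
  have hbi : ∀ ζ : testTuples n m, ⟪toL2Tuple b hb, testToL2 n m ζ⟫_ℝ
      = ∑ i, ∫ x, b i x * ζ.1 i x := fun ζ => inner_toL2Tuple_toL2Tuple _ _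
  have hk : ∀ k : ℕ, (0 : ℝ) < 1 / ((k : ℝ) + 1) := fun k => by positivity
  let w : ℕ → testTuples n m := fun k =>
    ⟨fun i x => smoothAbs (1 / ((k : ℝ) + 1)) (ζ.1 i x), fun i => (ht i).smoothAbs_comp (hk k)⟩
  set EE := ∑ i, ∫ x, ζ.1 i x * nonlocalOp K (ζ.1 i) x with hEE
  have hE : ∀ k, ∑ i, ∫ x, (w k).1 i x * nonlocalOp K ((w k).1 i) x ≤ EE := fun k =>
    Finset.sum_le_sum fun i _ => hK.energy_le_of_contraction (ht i) (isTestFunction_coe (w k) i)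
      fun x z => abs_smoothAbs_sub_le _ _ _
  have hlim : Tendsto (fun k => (1 / 2) * (EE
      - (∑ i, ∑ j, ∫ x, A x i j * (w k).1 i x * (w k).1 j x)
      + μ * ∑ i, ∫ x, (w k).1 i x * (w k).1 i x) - ∑ i, ∫ x, b i x * (w k).1 i x) atTop
      (𝓝 ((1 / 2) * (EE - (∑ i, ∑ j, ∫ x, A x i j * |ζ.1 i x| * |ζ.1 j x|)
      + μ * ∑ i, ∫ x, |ζ.1 i x| * |ζ.1 i x|) - ∑ i, ∫ x, b i x * |ζ.1 i x|)) := by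
    refine (((tendsto_const_nhds.sub (tendsto_finsetSum _ fun i _ => tendsto_finsetSum _
      fun j _ => tendsto_integral_mul_smoothAbs (hS.measurable i j) (fun x => hS.bound x i j)
        (ht i) (ht j))).add ((tendsto_finsetSum _ fun i _ => ?_).const_mul μ)).const_mul _).sub
      (tendsto_finsetSum _ fun i _ => tendsto_integral_mul_smoothAbs_left (hb i) (ht i))
    have h := tendsto_integral_mul_smoothAbs (a := fun _ => 1) (B := 1) measurable_const
      (by simp) (ht i) (ht i)
    simp only [one_mul] at h
    exact h
  have hle : (1 / 2) * (EE - (∑ i, ∑ j, ∫ x, A x i j * |ζ.1 i x| * |ζ.1 j x|)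
      + μ * ∑ i, ∫ x, |ζ.1 i x| * |ζ.1 i x|) - ∑ i, ∫ x, b i x * |ζ.1 i x|
      ≤ (1 / 2) * ⟪testToL2 n m ζ, systemToL2 hK hS μ ζ⟫_ℝ - ⟪toL2Tuple b hb, testToL2 n m ζ⟫_ℝ := by
    rw [inner_testToL2_systemToL2, hbi]
    have h1 : ∑ i, ∑ j, ∫ x, A x i j * ζ.1 i x * ζ.1 j x
        ≤ ∑ i, ∑ j, ∫ x, A x i j * |ζ.1 i x| * |ζ.1 j x| := by
      refine Finset.sum_le_sum fun i _ => Finset.sum_le_sum fun j _ => integral_mono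
        (integrable_coeff_mul hS (ht i).memLp (ht j).memLp i j)
        (integrable_coeff_mul hS (ht i).memLp.abs (ht j).memLp.abs i j) fun x => ?_
      simp only [mul_assoc]
      by_cases hij : i = j
      · subst hij; rw [abs_mul_abs_self]
      · rw [← abs_mul]
        exact mul_le_mul_of_nonneg_left (le_abs_self _) (hS.pos x i j hij).le
    have h2 : ∑ i, ∫ x, b i x * ζ.1 i x ≤ ∑ i, ∫ x, b i x * |ζ.1 i x| :=
      Finset.sum_le_sum fun i _ => integral_mono ((hb i).integrable_mul (ht i).memLp)
        ((hb i).integrable_mul (ht i).memLp.abs)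
        fun x => mul_le_mul_of_nonneg_left (le_abs_self _) (hb0 i x)
    simp only [abs_mul_abs_self]
    linarith
  obtain ⟨k, hk2⟩ := (hlim.eventually_lt_const (lt_of_le_of_lt hle (lt_add_of_pos_right _ hε))).exists
  refine ⟨w k, fun i x => smoothAbs_nonneg _, ?_⟩
  rw [inner_testToL2_systemToL2, hbi]
  linarith [hE k]

theorem locallyIntegrable_of_memLp {f : Rn n → ℝ} (hf : MemLp f 2) : LocallyIntegrable f :=
  hf.locallyIntegrable (by norm_num)

theorem systemOp_single (K : Rn n → ℝ) (A : Rn n → Matrix (Fin m) (Fin m) ℝ) (μ : ℝ) (i k : Fin m)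
    (η : Rn n → ℝ) (x : Rn n) : systemOp K A μ (Pi.single i η) k x
      = (if k = i then nonlocalOp K η x + μ * η x else 0) - A x k i * η x := by
  have h : ∑ j, A x k j * (Pi.single i η : Fin m → Rn n → ℝ) j x = A x k i * η x := by
    rw [Finset.sum_eq_single i]
    · simp
    · intro j _ hj; simp [Pi.single_eq_of_ne hj]
    · simp
  rw [systemOp, h]
  by_cases hk : k = i
  · subst hk; simp; ring
  · have : nonlocalOp K (0 : Rn n → ℝ) x = 0 := nonlocalOp_zero K x
    simp [hk, this]

/-- The resolvent of a stable cooperative system preserves positivity. -/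
theorem exists_resolvent (hK : KernelCondition K) (hS : IsStableCooperative K B A) (hμ : 0 < μ)
    {b : Fin m → Rn n → ℝ} (hb : ∀ i, MemLp (b i) 2) (hb0 : ∀ i x, 0 ≤ b i x) :
    ∃ w : Fin m → Rn n → ℝ, (∀ i x, 0 ≤ w i x) ∧ (∀ i, MemLp (w i) 2) ∧
      ∀ i, IsWeakSolution K (w i) (fun x => ∑ j, A x i j * w j x - μ * w i x + b i x) := by
  obtain ⟨u, hu, heq⟩ := exists_weak_minimizer (testToL2 n m) (systemToL2 hK hS μ)
    (inner_testToL2_systemToL2_comm hK hS) hμ (mul_norm_sq_le_inner_systemToL2 hK hS)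
    (toL2Tuple b hb) {ζ : testTuples n m | ∀ i x, 0 ≤ ζ.1 i x}
    fun ζ ε hε => exists_nonneg_almost_minimizer hK hS hb hb0 ζ hε
  -- The nonnegative cone is closed in L², so the closure of the nonnegative test tuples stays
  -- inside it.
  have hu0 : ∀ i, 0 ≤ u i := by
    intro i
    have hc : Continuous (fun v : L2Tuples n m => v i) :=
      PiLp.continuous_apply 2 (fun _ : Fin m => Lp ℝ 2 (volume : Measure (Rn n))) i
    have hcl : IsClosed {v : L2Tuples n m | 0 ≤ v i} := isClosed_le continuous_const hc
    refine (closure_minimal ?_ hcl) hu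
    rintro _ ⟨ζ, hζ, rfl⟩
    change (0 : Lp ℝ 2 volume) ≤ MemLp.toLp _ (isTestFunction_coe ζ i).memLp
    rw [← Lp.coeFn_nonneg]
    filter_upwards [((isTestFunction_coe ζ i).memLp).coeFn_toLp] with x hx
    rw [hx]; exact hζ i x
  -- A representative that is nonnegative everywhere, not only almost everywhere.
  set w : Fin m → Rn n → ℝ := fun i x => max (u i x) 0 with hw
  have hwu : ∀ i, w i =ᵐ[volume] u i := by
    intro i
    filter_upwards [(Lp.coeFn_nonneg _).2 (hu0 i)] with x hx
    exact max_eq_left hx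
  have hwL : ∀ i, MemLp (w i) 2 := fun i => (memLp_congr_ae (hwu i)).2 (Lp.memLp (u i))
  have hAw : ∀ i j, MemLp (fun x => A x i j * w j x) 2 := fun i j =>
    MemLp.bounded_mul (hwL j) (hS.measurable i j) fun x => hS.bound x i j
  refine ⟨w, fun i x => le_max_right _ _, hwL, fun i => ⟨locallyIntegrable_of_memLp (hwL i),
    locallyIntegrable_of_memLp (((memLp_finsetSum _ fun j _ => hAw i j).sub
      ((hwL i).const_mul μ)).add (hb i)), fun η hη => ?_⟩⟩
  have hs : ∀ k, IsTestFunction ((Pi.single i η : Fin m → Rn n → ℝ) k) := by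
    intro k
    by_cases hk : k = i
    · subst hk; simpa using hη
    · rw [Pi.single_eq_of_ne hk]; exact ⟨contDiff_const, HasCompactSupport.zero⟩
  -- A test tuple concentrated in slot i isolates the i-th equation. It produces column i of A,
  -- which symmetry turns into row i.
  let ζ : testTuples n m := ⟨Pi.single i η, hs⟩
  have h1 := heq ζ
  have h2 : ⟪u, systemToL2 hK hS μ ζ⟫_ℝ = ∑ k, ∫ x, u k x * systemOp K A μ (Pi.single i η) k x :=
    inner_toL2Tuple u _
  have h3 : ⟪toL2Tuple b hb, testToL2 n m ζ⟫_ℝ = ∫ x, b i x * η x := by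
    refine (inner_toL2Tuple_toL2Tuple _ _).trans ?_
    change ∑ k, ∫ x, b k x * (Pi.single i η : Fin m → Rn n → ℝ) k x = _
    rw [Finset.sum_eq_single i]
    · simp
    · intro j _ hj; simp [Pi.single_eq_of_ne hj]
    · simp
  have j1 : Integrable (fun x => w i x * nonlocalOp K η x) :=
    (hwL i).integrable_mul (hK.memLp_nonlocalOp hη)
  have j2 : Integrable (fun x => w i x * η x) := (hwL i).integrable_mul hη.memLp
  have j3 : ∀ k, Integrable (fun x => A x i k * w k x * η x) := fun k =>
    (hAw i k).integrable_mul hη.memLp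
  have j4 : Integrable (fun x => b i x * η x) := (hb i).integrable_mul hη.memLp
  have j5 : Integrable (fun x => w i x * nonlocalOp K η x + μ * (w i x * η x)) :=
    j1.add (j2.const_mul μ)
  have h4 : ∀ k, ∫ x, u k x * systemOp K A μ (Pi.single i η) k x
      = (if k = i then (∫ x, w i x * nonlocalOp K η x) + μ * ∫ x, w i x * η x else 0)
        - ∫ x, A x i k * w k x * η x := by
    intro k
    have e1 : ∫ x, u k x * systemOp K A μ (Pi.single i η) k x
        = ∫ x, ((if k = i then w i x * nonlocalOp K η x + μ * (w i x * η x) else 0)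
          - A x i k * w k x * η x) := by
      refine integral_congr_ae ?_
      filter_upwards [hwu k] with x hx
      rw [systemOp_single, ← hx, hS.symm x k i]
      by_cases hk : k = i
      · subst hk; simp only [if_true]; ring
      · simp only [hk, if_false]; ring
    rw [e1]
    by_cases hk : k = i
    · simp only [hk, if_true]
      rw [integral_sub j5 (j3 i), integral_add j1 (j2.const_mul μ), integral_const_mul]
    · simp only [hk, if_false, zero_sub, integral_neg]
  rw [h2, h3] at h1
  simp only [h4, Finset.sum_sub_distrib, Finset.sum_ite_eq', Finset.mem_univ, if_true] at h1
  have j6 : Integrable (fun x => ∑ j, A x i j * w j x * η x) :=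
    integrable_finsetSum _ fun j _ => j3 j
  have j7 : Integrable (fun x => (∑ j, A x i j * w j x * η x) - μ * (w i x * η x)) :=
    j6.sub (j2.const_mul μ)
  have h5 : ∫ x, (∑ j, A x i j * w j x - μ * w i x + b i x) * η x
      = (∑ j, ∫ x, A x i j * w j x * η x) - μ * (∫ x, w i x * η x) + ∫ x, b i x * η x := by
    rw [← integral_finsetSum _ fun j _ => j3 j, ← integral_const_mul,
      ← integral_sub j6 (j2.const_mul μ), ← integral_add j7 j4]
    congr 1; ext x
    rw [add_mul, sub_mul, Finset.sum_mul]
    ring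
  rw [h5]
  linarith

end Resolvent

/-! ### Gaussian sources -/

section Gaussian

variable {n m : ℕ} {K : Rn n → ℝ} {B μ : ℝ} {A : Rn n → Matrix (Fin m) (Fin m) ℝ}

/-- The Gaussian centred at `a`. -/
noncomputable def gaussianAt (a x : Rn n) : ℝ := Real.exp (-‖x - a‖ ^ 2)

theorem gaussianAt_pos (a x : Rn n) : 0 < gaussianAt a x := Real.exp_pos _

theorem contDiff_gaussianAt (a : Rn n) : ContDiff ℝ 2 (gaussianAt a) := by
  unfold gaussianAt
  exact Real.contDiff_exp.comp ((contDiff_id.sub contDiff_const).norm_sq ℝ).neg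

theorem integrable_gaussianAt (a : Rn n) : Integrable (gaussianAt a) := by
  have h := (GaussianFourier.integrable_cexp_neg_mul_sq_norm_add (V := Rn n) (b := 1)
    (by simp) 0 0).norm
  have h2 : Integrable (fun v : Rn n => Real.exp (-‖v‖ ^ 2)) := by
    refine h.congr (Eventually.of_forall fun v => ?_)
    simp only [Complex.norm_exp]
    congr 1
    simp [← Complex.ofReal_pow]
  exact h2.comp_sub_right a

theorem secondDiff_exp_neg_sq (X Y s : ℝ) :
    2 * Real.exp (-X) - Real.exp (-(X + 2 * s + Y)) - Real.exp (-(X - 2 * s + Y))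
      = Real.exp (-X) * (2 - Real.exp (-Y) * (Real.exp (-(2 * s)) + Real.exp (2 * s))) := by
  rw [show -(X + 2 * s + Y) = -X + (-Y + -(2 * s)) by ring,
    show -(X - 2 * s + Y) = -X + (-Y + 2 * s) by ring]
  simp only [Real.exp_add]
  ring

theorem secondDiff_gaussianAt (a x y : Rn n) : secondDiff (gaussianAt a) x y
    = gaussianAt a x * (2 - Real.exp (-‖y‖ ^ 2) * (Real.exp (-(2 * inner ℝ (x - a) y))
      + Real.exp (2 * inner ℝ (x - a) y))) := by
  have h1 : ‖x + y - a‖ ^ 2 = ‖x - a‖ ^ 2 + 2 * inner ℝ (x - a) y + ‖y‖ ^ 2 := by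
    rw [← norm_add_sq_real]; congr 2; abel
  have h2 : ‖x - y - a‖ ^ 2 = ‖x - a‖ ^ 2 - 2 * inner ℝ (x - a) y + ‖y‖ ^ 2 := by
    rw [← norm_sub_sq_real]; congr 2; abel
  simp only [secondDiff, gaussianAt, h1, h2]
  exact secondDiff_exp_neg_sq _ _ _

theorem two_le_exp_add_exp (t : ℝ) : 2 ≤ Real.exp (-t) + Real.exp t := by
  have := Real.one_le_cosh t
  rw [Real.cosh_eq] at this
  linarith

theorem abs_exp_sub_sum_le (t : ℝ) (k : ℕ) :
    |Real.exp t - ∑ i ∈ Finset.range k, t ^ i / i.factorial| ≤ |t| ^ k * Real.exp |t| := by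
  have h := Complex.norm_exp_sub_sum_le_norm_mul_exp (t : ℂ) k
  rw [Complex.norm_real, Real.norm_eq_abs] at h
  rw [← Real.norm_eq_abs, ← Complex.norm_real]
  push_cast
  exact h

/-- The first-order Taylor terms of the two exponentials cancel, leaving a quadratic remainder. -/
theorem exp_add_exp_le (t : ℝ) :
    Real.exp (-t) + Real.exp t ≤ 2 + 2 * (t ^ 2 * Real.exp |t|) := by
  have h1 := abs_exp_sub_sum_le t 2
  have h2 := abs_exp_sub_sum_le (-t) 2
  simp only [Finset.sum_range_succ, Finset.sum_range_zero, abs_neg, sq_abs] at h1 h2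
  have h3 := (abs_le.1 h1).2
  have h4 := (abs_le.1 h2).2
  norm_num at h3 h4
  linarith

/-- By convexity of the exponential the hyperbolic factor is at least 2, and 1 − exp(−‖y‖²) ≤ ‖y‖².
The one-sided bound keeps the full Gaussian factor, which is what later gives a nonnegative source.
-/
theorem secondDiff_gaussianAt_le (a x y : Rn n) :
    secondDiff (gaussianAt a) x y ≤ 2 * gaussianAt a x * ‖y‖ ^ 2 := by
  rw [secondDiff_gaussianAt]
  have h1 := Real.one_sub_le_exp_neg (‖y‖ ^ 2)
  have h2 := two_le_exp_add_exp (2 * inner ℝ (x - a) y)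
  have h3 : Real.exp (-‖y‖ ^ 2) * 2 ≤ Real.exp (-‖y‖ ^ 2) * (Real.exp (-(2 * inner ℝ (x - a) y))
      + Real.exp (2 * inner ℝ (x - a) y)) := mul_le_mul_of_nonneg_left h2 (Real.exp_pos _).le
  have h4 : 2 - Real.exp (-‖y‖ ^ 2) * (Real.exp (-(2 * inner ℝ (x - a) y))
      + Real.exp (2 * inner ℝ (x - a) y)) ≤ 2 * ‖y‖ ^ 2 := by linarith
  calc _ ≤ gaussianAt a x * (2 * ‖y‖ ^ 2) := mul_le_mul_of_nonneg_left h4 (gaussianAt_pos a x).le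
    _ = _ := by ring

/-- Half of the Gaussian decay is spent: r²/4 ≤ exp(r²/4), and 2r ≤ r²/4 + 4. -/
theorem exp_mul_poly_le (r : ℝ) :
    Real.exp (-r ^ 2) * (8 * r ^ 2 * Real.exp (2 * r)) ≤ 32 * Real.exp 4 * Real.exp (-r ^ 2 / 2) := by
  have h1 : r ^ 2 / 4 ≤ Real.exp (r ^ 2 / 4) := by linarith [Real.add_one_le_exp (r ^ 2 / 4)]
  have h2 : Real.exp (-r ^ 2) * Real.exp (2 * r) * Real.exp (r ^ 2 / 4)
      ≤ Real.exp 4 * Real.exp (-r ^ 2 / 2) := by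
    rw [← Real.exp_add, ← Real.exp_add, ← Real.exp_add]
    refine Real.exp_le_exp.2 ?_
    nlinarith [sq_nonneg (r / 2 - 2)]
  calc Real.exp (-r ^ 2) * (8 * r ^ 2 * Real.exp (2 * r))
      = 32 * (Real.exp (-r ^ 2) * Real.exp (2 * r) * (r ^ 2 / 4)) := by ring
    _ ≤ 32 * (Real.exp (-r ^ 2) * Real.exp (2 * r) * Real.exp (r ^ 2 / 4)) := by gcongr
    _ ≤ 32 * (Real.exp 4 * Real.exp (-r ^ 2 / 2)) := by gcongr
    _ = _ := by ring

/-- The two-sided bound loses part of the decay, which is harmless: it only serves to place L of the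
Gaussian in L². -/
theorem abs_secondDiff_gaussianAt_le (a x y : Rn n) (hy : ‖y‖ ≤ 1) :
    |secondDiff (gaussianAt a) x y|
      ≤ 32 * Real.exp 4 * Real.exp (-‖x - a‖ ^ 2 / 2) * ‖y‖ ^ 2 := by
  rw [abs_le']
  constructor
  · refine (secondDiff_gaussianAt_le a x y).trans ?_
    have h1 : gaussianAt a x ≤ Real.exp (-‖x - a‖ ^ 2 / 2) :=
      Real.exp_le_exp.2 (by nlinarith [sq_nonneg ‖x - a‖])
    have h2 : (1 : ℝ) ≤ Real.exp 4 := Real.one_le_exp (by norm_num)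
    have h3 := Real.exp_pos (-‖x - a‖ ^ 2 / 2)
    refine mul_le_mul_of_nonneg_right ?_ (by positivity)
    nlinarith
  · rw [secondDiff_gaussianAt, neg_mul_eq_mul_neg]
    set t : ℝ := 2 * inner ℝ (x - a) y with ht
    have hs : |t| ≤ 2 * ‖x - a‖ * ‖y‖ := by
      rw [ht, abs_mul, abs_two, mul_assoc]
      exact mul_le_mul_of_nonneg_left (abs_real_inner_le_norm _ _) (by norm_num)
    have hs1 : |t| ≤ 2 * ‖x - a‖ := hs.trans
      (mul_le_of_le_one_right (by positivity) hy)
    have hs2 : t ^ 2 ≤ 4 * ‖x - a‖ ^ 2 * ‖y‖ ^ 2 := by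
      rw [← sq_abs]
      refine (pow_le_pow_left₀ (abs_nonneg _) hs 2).trans (le_of_eq (by ring))
    have h1 : Real.exp (-‖y‖ ^ 2) ≤ 1 := Real.exp_le_one_iff.2 (by nlinarith [sq_nonneg ‖y‖])
    have h2 := exp_add_exp_le t
    have h3 : Real.exp (-‖y‖ ^ 2) * (Real.exp (-t) + Real.exp t) ≤ Real.exp (-t) + Real.exp t :=
      mul_le_of_le_one_left (by positivity) h1
    have h4 : t ^ 2 * Real.exp |t| ≤ 4 * ‖x - a‖ ^ 2 * ‖y‖ ^ 2 * Real.exp (2 * ‖x - a‖) := by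
      gcongr
    have h5 : -(2 - Real.exp (-‖y‖ ^ 2) * (Real.exp (-t) + Real.exp t))
        ≤ 8 * ‖x - a‖ ^ 2 * Real.exp (2 * ‖x - a‖) * ‖y‖ ^ 2 := by linarith
    calc _ ≤ gaussianAt a x * (8 * ‖x - a‖ ^ 2 * Real.exp (2 * ‖x - a‖) * ‖y‖ ^ 2) :=
          mul_le_mul_of_nonneg_left h5 (gaussianAt_pos a x).le
      _ = Real.exp (-‖x - a‖ ^ 2) * (8 * ‖x - a‖ ^ 2 * Real.exp (2 * ‖x - a‖)) * ‖y‖ ^ 2 := by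
          rw [gaussianAt]; ring
      _ ≤ _ := mul_le_mul_of_nonneg_right (exp_mul_poly_le _) (by positivity)

theorem KernelCondition.nonlocalOp_gaussianAt_le (hK : KernelCondition K) (a x : Rn n) :
    nonlocalOp K (gaussianAt a) x ≤ (∫ y, ‖y‖ ^ 2 * K y) * gaussianAt a x := by
  have h : ∫ y, secondDiff (gaussianAt a) x y * K y
      ≤ ∫ y, 2 * gaussianAt a x * (‖y‖ ^ 2 * K y) :=
    integral_mono (hK.integrable_secondDiff (contDiff_gaussianAt a) x) (hK.moment.const_mul _)
      fun y => by
        rw [← mul_assoc]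
        exact mul_le_mul_of_nonneg_right (secondDiff_gaussianAt_le a x y) (hK.nonneg y)
  rw [integral_const_mul] at h
  rw [nonlocalOp_eq_secondDiff]
  linarith

theorem memLp_sqrt_gaussianAt (a : Rn n) :
    MemLp (fun x : Rn n => Real.exp (-‖x - a‖ ^ 2 / 2)) 2 := by
  have hc : Continuous (fun x : Rn n => Real.exp (-‖x - a‖ ^ 2 / 2)) := by fun_prop
  refine (memLp_two_iff_integrable_sq hc.aestronglyMeasurable).2
    ((integrable_gaussianAt a).congr (Eventually.of_forall fun x => ?_))
  change Real.exp _ = Real.exp (-‖x - a‖ ^ 2 / 2) ^ 2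
  rw [← Real.exp_nat_mul]
  congr 1; push_cast; ring

theorem memLp_gaussianAt (a : Rn n) : MemLp (gaussianAt a) 2 := by
  refine (memLp_sqrt_gaussianAt a).mono (contDiff_gaussianAt a).continuous.aestronglyMeasurable
    (Eventually.of_forall fun x => ?_)
  rw [Real.norm_of_nonneg (gaussianAt_pos a x).le, Real.norm_of_nonneg (Real.exp_pos _).le]
  exact Real.exp_le_exp.2 (by nlinarith [sq_nonneg ‖x - a‖])

theorem KernelCondition.memLp_nonlocalOp_gaussianAt (hK : KernelCondition K) (a : Rn n) :
    MemLp (nonlocalOp K (gaussianAt a)) 2 := by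
  refine MemLp.of_le_mul (c := 32 * Real.exp 4 * ∫ y, ‖y‖ ^ 2 * K y) (memLp_sqrt_gaussianAt a)
    (hK.measurable_nonlocalOp (contDiff_gaussianAt a).continuous).aestronglyMeasurable
    (Eventually.of_forall fun x => ?_)
  refine (hK.abs_nonlocalOp_le fun y hy => abs_secondDiff_gaussianAt_le a x y hy).trans
    (le_of_eq ?_)
  rw [Real.norm_of_nonneg (Real.exp_pos _).le]
  ring

theorem KernelCondition.integrable_mul_nonlocalOp (hK : KernelCondition K) {f η : Rn n → ℝ}
    (hf : LocallyIntegrable f) (hη : IsTestFunction η) :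
    Integrable (fun x => f x * nonlocalOp K η x) := by
  refine ((hK.integrable_prod_mul_secondDiff hf hη).integral_prod_left.const_mul (1 / 2)).congr
    (Eventually.of_forall fun x => ?_)
  simp only [nonlocalOp_eq_secondDiff, integral_const_mul]
  ring

theorem IsWeakSolution.add (hK : KernelCondition K) {f g F G : Rn n → ℝ}
    (hf : IsWeakSolution K f F) (hg : IsWeakSolution K g G) :
    IsWeakSolution K (fun x => f x + g x) (fun x => F x + G x) := by
  refine ⟨hf.left.add hg.left, hf.right.add hg.right, fun η hη => ?_⟩
  simp only [add_mul]
  rw [integral_add (hK.integrable_mul_nonlocalOp hf.left hη)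
    (hK.integrable_mul_nonlocalOp hg.left hη), integral_add (integrable_mul_test hf.right hη)
    (integrable_mul_test hg.right hη), hf.eq η hη, hg.eq η hη]

theorem IsWeakSolution.const_mul {f F : Rn n → ℝ}
    (hf : IsWeakSolution K f F) (c : ℝ) :
    IsWeakSolution K (fun x => c * f x) (fun x => c * F x) := by
  refine ⟨hf.left.smul c, hf.right.smul c, fun η hη => ?_⟩
  simp only [mul_assoc, integral_const_mul, hf.eq η hη]

theorem abs_sum_coeff_le (hS : IsStableCooperative K B A) (x : Rn n) (i : Fin m) :
    |∑ j, A x i j| ≤ m * B := by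
  refine (Finset.abs_sum_le_sum_abs _ _).trans ((Finset.sum_le_sum fun j _ =>
    hS.bound x i j).trans (le_of_eq ?_))
  simp

/-- Solutions of the perturbed system with a Gaussian source that are bounded below by the
Gaussian. -/
theorem exists_solution_gaussian_source (hK : KernelCondition K) (hS : IsStableCooperative K B A)
    (hμ : 0 < μ) (hμ1 : μ ≤ 1) (a : Rn n) :
    ∃ u : Fin m → Rn n → ℝ, (∀ i x, gaussianAt a x ≤ u i x) ∧
      ∀ i, IsWeakSolution K (u i) (fun x => ∑ j, A x i j * u j x - μ * u i x
        + ((∫ y, ‖y‖ ^ 2 * K y) + m * B + 1) * gaussianAt a x) := by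
  set C := (∫ y, ‖y‖ ^ 2 * K y) + m * B + 1 with hC
  -- With g the Gaussian, b = Cg − (L − A + μ)g, so w solves the problem with source b exactly when
  -- g + w solves it with source Cg. The summands of C absorb Lg, the row sums of A and μ ≤ 1,
  -- whence b ≥ 0.
  set b : Fin m → Rn n → ℝ := fun i x => C * gaussianAt a x - nonlocalOp K (gaussianAt a) x
    + ∑ j, A x i j * gaussianAt a x - μ * gaussianAt a x with hb
  have hg := memLp_gaussianAt a
  have hbL : ∀ i, MemLp (b i) 2 := fun i =>
    (((hg.const_mul C).sub (hK.memLp_nonlocalOp_gaussianAt a)).add (memLp_finsetSum _ fun j _ =>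
      MemLp.bounded_mul hg (hS.measurable i j) fun x => hS.bound x i j)).sub (hg.const_mul μ)
  have hb0 : ∀ i x, 0 ≤ b i x := by
    intro i x
    have h1 := hK.nonlocalOp_gaussianAt_le a x
    have h2 := (abs_le.1 (abs_sum_coeff_le hS x i)).1
    have h3 := gaussianAt_pos a x
    simp only [hb, hC, ← Finset.sum_mul]
    nlinarith [mul_le_mul_of_nonneg_right h2 h3.le, mul_le_mul_of_nonneg_right hμ1 h3.le]
  obtain ⟨w, hw0, hwL, hw⟩ := exists_resolvent hK hS hμ hbL hb0
  refine ⟨fun i x => gaussianAt a x + w i x, fun i x => le_add_of_nonneg_right (hw0 i x),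
    fun i => ?_⟩
  convert (hK.isSolution_nonlocalOp (contDiff_gaussianAt a)).isWeakSolution.add hK (hw i) using 1
  ext x
  simp only [hb, mul_add, Finset.sum_add_distrib]
  ring

end Gaussian

/-! ### Harnack chains and local Hölder estimates -/

section Estimates

variable {n : ℕ} {K : Rn n → ℝ}

/-- A nonnegative v with |Lv| ≤ Λv solves Lv + gv = 0 with g = −Lv/v bounded by |Λ|, so (B) applies
with a constant independent of v and can be iterated along a segment. -/
theorem HarnackCondition.exists_chain (hK : KernelCondition K) (hB : HarnackCondition K) (Λ : ℝ) :
    ∃ C : ℝ, 1 ≤ C ∧ ∀ v : Rn n → ℝ, ContDiff ℝ 2 v → (∀ x, 0 ≤ v x) →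
      (∀ x, |nonlocalOp K v x| ≤ Λ * v x) →
      ∀ (N : ℕ) (x y : Rn n), dist x y ≤ N / 2 → v x ≤ C ^ N * v y := by
  obtain ⟨C, hC, hH⟩ := hB |Λ|
  refine ⟨max C 1, le_max_right _ _, fun v hv hv0 hLv => ?_⟩
  have hvm := hv.continuous.measurable
  set g : Rn n → ℝ := fun x => -(nonlocalOp K v x / v x) with hg
  -- At a zero of v the hypothesis forces Lv = 0, so the value 0 of the quotient there is
  -- consistent.
  have hgv : ∀ x, -(g x * v x) = nonlocalOp K v x := by
    intro x
    by_cases hx : v x = 0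
    · have := hLv x
      rw [hx, mul_zero] at this
      simp [hx, abs_eq_zero.1 (le_antisymm this (abs_nonneg _))]
    · simp only [hg]; field_simp
  have hgb : ∀ x, |g x| ≤ |Λ| := by
    intro x
    rcases (hv0 x).eq_or_lt with hx | hx
    · simp [hg, ← hx]
    · rw [hg, abs_neg, abs_div, abs_of_pos hx, div_le_iff₀ hx]
      exact (hLv x).trans (mul_le_mul_of_nonneg_right (le_abs_self _) hx.le)
  have hsol : IsSolution K v (fun x => -(g x * v x)) := by
    rw [funext hgv]; exact hK.isSolution_nonlocalOp hv
  have hstep : ∀ x y, dist x y < 1 → v x ≤ max C 1 * v y := fun x y hxy =>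
    (hH v g ((hK.measurable_nonlocalOp hv.continuous).div hvm).neg hgb hv0 hsol y x hxy y
      (Metric.mem_ball_self one_pos)).trans
      (mul_le_mul_of_nonneg_right (le_max_left _ _) (hv0 y))
  intro N
  induction N with
  | zero =>
    intro x y hxy
    have : x = y := dist_le_zero.1 (by simpa using hxy)
    simp [this]
  | succ N ih =>
    intro x y hxy
    have hN : (0 : ℝ) < (N : ℝ) + 1 := by positivity
    push_cast at hxy
    -- The first of N + 1 equal steps, each of length at most 1/2 and so inside one unit ball.
    set z := AffineMap.lineMap x y (1 / ((N : ℝ) + 1)) with hz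
    have h1 : dist x z < 1 := by
      rw [hz, dist_left_lineMap, Real.norm_of_nonneg (by positivity), one_div, inv_mul_lt_iff₀ hN]
      linarith
    have h2 : dist z y ≤ N / 2 := by
      rw [hz, dist_lineMap_right, Real.norm_of_nonneg (by
        rw [sub_nonneg, div_le_one hN]; linarith [(Nat.cast_nonneg N : (0 : ℝ) ≤ N)])]
      have e : (1 : ℝ) - 1 / (N + 1) = N / (N + 1) := by field_simp; ring
      rw [e, div_mul_eq_mul_div, div_le_iff₀ hN]
      nlinarith [(Nat.cast_nonneg N : (0 : ℝ) ≤ N)]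
    calc v x ≤ max C 1 * v z := hstep x z h1
      _ ≤ max C 1 * (max C 1 ^ N * v y) :=
          mul_le_mul_of_nonneg_left (ih z y h2) (by positivity)
      _ = _ := by ring

/-- (C) asks for a globally bounded solution near the origin. Translate, and cut off with a bump
equal to 1 on the ball of radius 2: the kernel has range 1, so L is unchanged on the unit ball. -/
theorem HolderCondition.exists_local (hK : KernelCondition K) (hC : HolderCondition K) :
    ∃ α C : ℝ, 0 < α ∧ 0 < C ∧ ∀ v : Rn n → ℝ, ContDiff ℝ 2 v → ∀ (x₀ : Rn n) (M N : ℝ),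
      (∀ x, dist x x₀ < 3 → |v x| ≤ M) → (∀ x, dist x x₀ < 1 → |nonlocalOp K v x| ≤ N) →
      ∀ y z, dist y x₀ < 1 / 2 → dist z x₀ < 1 / 2 →
        |v y - v z| ≤ C * (N + M) * dist y z ^ α := by
  obtain ⟨α, C, hα, -, hC0, hH⟩ := hC
  refine ⟨α, C, hα, hC0, fun v hv x₀ M N hM hN y z hy hz => ?_⟩
  let χ : ContDiffBump x₀ := ⟨2, 3, by norm_num, by norm_num⟩
  have hM0 : 0 ≤ M := (abs_nonneg _).trans (hM x₀ (by simp))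
  set w : Rn n → ℝ := fun x => χ x * v x with hw
  have hwC : ContDiff ℝ 2 w := χ.contDiff.mul hv
  have hw1 : ∀ x, dist x x₀ ≤ 2 → w x = v x := fun x hx => by
    simp only [hw]; rw [χ.one_of_mem_closedBall hx, one_mul]
  have hwb : ∀ x, |w x| ≤ M := by
    intro x
    by_cases hx : dist x x₀ < 3
    · simp only [hw]
      rw [abs_mul, abs_of_nonneg χ.nonneg]
      exact (mul_le_of_le_one_left (abs_nonneg _) χ.le_one).trans (hM x hx)
    · simp only [hw]
      rw [χ.zero_of_le_dist (not_lt.1 hx)]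
      simpa using hM0
  have hLw : ∀ x, dist x x₀ < 1 → nonlocalOp K w x = nonlocalOp K v x := fun x hx =>
    hK.nonlocalOp_congr fun z hz => hw1 z ((dist_triangle z x x₀).trans (by linarith))
  set f : Rn n → ℝ := fun x => w (x + x₀) with hf
  have hfC : ContDiff ℝ 2 f := hwC.comp (contDiff_id.add contDiff_const)
  have hsol := hK.isSolution_nonlocalOp hfC
  have key := hH f (nonlocalOp K f) M N hsol (fun x => hwb _) (fun x hx => by
    have hx' : dist (x + x₀) x₀ < 1 := by simpa [dist_eq_norm] using hx
    rw [hf, nonlocalOp_comp_add_right, hLw _ hx']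
    exact hN _ hx') 0 (by simp) (y - x₀) (by simpa [dist_eq_norm] using hy) (z - x₀)
      (by simpa [dist_eq_norm] using hz)
  simp only [hf, sub_add_cancel, dist_sub_right] at key
  rw [hw1 y (by linarith), hw1 z (by linarith)] at key
  have h1 : |v y - v z| / dist y z ^ α ≤ C * (N + M) := by linarith [abs_nonneg (w (0 + x₀))]
  by_cases hyz : y = z
  · subst hyz; simp [Real.zero_rpow hα.ne']
  · rwa [div_le_iff₀ (Real.rpow_pos_of_pos (dist_pos.2 hyz) α)] at h1

end Estimates

/-! ### Normalised approximate solutions -/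

section Approximation

variable {n m : ℕ} {K : Rn n → ℝ} {B μ : ℝ} {A : Rn n → Matrix (Fin m) (Fin m) ℝ}

/-- If the mollifications of a nonnegative tuple satisfy Harnack chains uniformly in the scale, they
converge in `L¹` on bounded sets. -/
theorem exists_mollify_close [NeZero m] {u : Fin m → Rn n → ℝ} (hu : ∀ i, LocallyIntegrable (u i))
    (hu0 : ∀ i x, 0 ≤ u i x) {C : ℝ}
    (hC : ∀ (j N : ℕ) (x y : Rn n), dist x y ≤ N / 2 →
      ∑ i, mollify j (u i) x ≤ C ^ N * ∑ i, mollify j (u i) y)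
    (R : ℝ) {ε : ℝ} (hε : 0 < ε) :
    ∃ j, ∀ i, ∫ x in Metric.closedBall 0 R, |u i x - mollify j (u i) x| ≤ ε := by
  -- At one point of convergence y the mollifications are bounded; the Harnack chain spreads this
  -- bound over the ball, and dominated convergence applies.
  obtain ⟨y, hy⟩ := (eventually_all.2 fun i => ae_tendsto_mollify (hu i)).exists
  have hsum : Tendsto (fun j => ∑ i, mollify j (u i) y) atTop (𝓝 (∑ i, u i y)) :=
    tendsto_finsetSum _ fun i _ => hy i
  have hev := hsum.eventually_lt_const (lt_add_one _)
  obtain ⟨N, hN⟩ := exists_nat_ge (2 * (R + ‖y‖))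
  have hbound : ∀ᶠ j in atTop, ∀ i, ∀ x ∈ Metric.closedBall (0 : Rn n) R,
      mollify j (u i) x ≤ |C| ^ N * (∑ i, u i y + 1) := by
    filter_upwards [hev] with j hj i x hx
    have h1 : dist x y ≤ N / 2 := by
      have := dist_triangle x 0 y
      rw [dist_zero_left] at this
      have hx' : dist x 0 ≤ R := hx
      linarith
    have h2 : mollify j (u i) x ≤ ∑ i, mollify j (u i) x :=
      Finset.single_le_sum (f := fun i => mollify j (u i) x)
        (fun i _ => mollify_nonneg j (hu0 i) x) (Finset.mem_univ i)
    have h3 : 0 ≤ ∑ i, mollify j (u i) y := Finset.sum_nonneg fun i _ => mollify_nonneg j (hu0 i) y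
    calc _ ≤ _ := h2
      _ ≤ _ := hC j N x y h1
      _ ≤ |C| ^ N * ∑ i, mollify j (u i) y := by
          rw [← abs_pow]; exact mul_le_mul_of_nonneg_right (le_abs_self _) h3
      _ ≤ _ := by gcongr
  have hlim : ∀ i, Tendsto (fun j => ∫ x in Metric.closedBall 0 R, |u i x - mollify j (u i) x|)
      atTop (𝓝 0) := by
    intro i
    have hfin : IsFiniteMeasure (volume.restrict (Metric.closedBall (0 : Rn n) R)) :=
      ⟨by simpa using (isCompact_closedBall (0 : Rn n) R).measure_lt_top⟩
    have h := tendsto_integral_filter_of_dominated_convergence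
      (μ := volume.restrict (Metric.closedBall (0 : Rn n) R)) (l := atTop)
      (F := fun j x => |u i x - mollify j (u i) x|) (f := fun _ => 0)
      (fun x => |u i x| + |C| ^ N * (∑ i, u i y + 1))
      (Eventually.of_forall fun j => ((hu i).aestronglyMeasurable.restrict.sub
        (contDiff_two_mollify j (hu i)).continuous.aestronglyMeasurable).norm) ?_
      (((hu i).integrableOn_isCompact (isCompact_closedBall _ _)).abs.add (integrable_const _)) ?_
    · simpa using h
    · filter_upwards [hbound] with j hj
      filter_upwards [ae_restrict_mem measurableSet_closedBall] with x hx
      rw [Real.norm_eq_abs, abs_abs]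
      refine (abs_sub _ _).trans (add_le_add_right ?_ _)
      rw [abs_of_nonneg (mollify_nonneg j (hu0 i) x)]
      exact hj i x hx
    · filter_upwards [ae_restrict_of_ae (ae_tendsto_mollify (hu i))] with x hx
      simpa using ((tendsto_const_nhds (x := u i x)).sub hx).abs
  obtain ⟨j, hj⟩ := (eventually_all.2 fun i => (hlim i).eventually_lt_const hε).exists
  exact ⟨j, fun i => (hj i).le⟩

/-- Data of a normalised approximate solution with radius `k`: a nonnegative weak solution `u` of the
perturbed system with source `s`, and a smooth approximation `U` of it. -/
structure IsApproximation (K : Rn n → ℝ) (A : Rn n → Matrix (Fin m) (Fin m) ℝ) (Λ C μ δ R : ℝ)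
    (u U : Fin m → Rn n → ℝ) (s : Rn n → ℝ) : Prop where
  weak : ∀ i, IsWeakSolution K (u i) (fun x => ∑ j, A x i j * u j x - μ * u i x + s x)
  smooth : ∀ i, ContDiff ℝ 2 (U i)
  nonneg : ∀ i x, 0 ≤ U i x
  normalised : ∑ i, U i 0 = 1
  op_bound : ∀ i x, |nonlocalOp K (U i) x| ≤ Λ * ∑ j, U j x
  harnack : ∀ (N : ℕ) (x y : Rn n), dist x y ≤ N / 2 → ∑ i, U i x ≤ C ^ N * ∑ i, U i y
  source_continuous : Continuous s
  source_nonneg : ∀ x, 0 ≤ s x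
  source_le : ∀ x, ‖x‖ ≤ R / 2 → s x ≤ δ
  close : ∀ i, ∫ x in Metric.closedBall 0 R, |u i x - U i x| ≤ δ

/-- The lower bound u_j ≥ g lets the solution absorb its own source, so the Harnack inequality for
the homogeneous equation remains available. -/
theorem abs_rhs_le (hS : IsStableCooperative K B A) (hμ : 0 < μ) (hμ1 : μ ≤ 1)
    {u : Fin m → Rn n → ℝ} {C g : ℝ} {x : Rn n} (hC : 0 ≤ C) (hg : 0 ≤ g) {i : Fin m}
    (hu : ∀ j, g ≤ u j x) :
    |∑ j, A x i j * u j x - μ * u i x + C * g| ≤ (B + 1 + C) * ∑ j, u j x := by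
  have hu0 : ∀ j, 0 ≤ u j x := fun j => hg.trans (hu j)
  have h1 : u i x ≤ ∑ j, u j x :=
    Finset.single_le_sum (f := fun j => u j x) (fun j _ => hu0 j) (Finset.mem_univ i)
  have h2 : |∑ j, A x i j * u j x| ≤ B * ∑ j, u j x := by
    rw [Finset.mul_sum]
    refine (Finset.abs_sum_le_sum_abs _ _).trans (Finset.sum_le_sum fun j _ => ?_)
    rw [abs_mul, abs_of_nonneg (hu0 j)]
    exact mul_le_mul_of_nonneg_right (hS.bound x i j) (hu0 j)
  have h3 : 0 ≤ μ * u i x := mul_nonneg hμ.le (hu0 i)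
  have h4 : μ * u i x ≤ 1 * u i x := mul_le_mul_of_nonneg_right hμ1 (hu0 i)
  have h5 : C * g ≤ C * u i x := mul_le_mul_of_nonneg_left (hu i) hC
  have h6 : C * u i x ≤ C * ∑ j, u j x := mul_le_mul_of_nonneg_left h1 hC
  have h7 : 0 ≤ C * g := mul_nonneg hC hg
  rw [abs_le] at h2 ⊢
  constructor <;> nlinarith

theorem tendsto_pow_mul_exp_neg_sq (C D : ℝ) (hC : 1 ≤ C) :
    Tendsto (fun k : ℕ => D * (C ^ (2 * k) * Real.exp (-((k : ℝ) / 2) ^ 2))) atTop (𝓝 0) := by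
  have hC0 : 0 < C := by linarith
  -- From this threshold on, k²/4 ≥ 2k log C + k, so the product is at most exp(−k).
  obtain ⟨N, hN⟩ := exists_nat_ge (4 * (2 * Real.log C + 1))
  have h1 : Tendsto (fun k : ℕ => Real.exp (-(k : ℝ))) atTop (𝓝 0) :=
    Real.tendsto_exp_neg_atTop_nhds_zero.comp tendsto_natCast_atTop_atTop
  have h2 : Tendsto (fun k : ℕ => C ^ (2 * k) * Real.exp (-((k : ℝ) / 2) ^ 2)) atTop (𝓝 0) := by
    refine squeeze_zero' (Eventually.of_forall fun k => by positivity) ?_ h1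
    filter_upwards [eventually_ge_atTop N] with k hk
    have hk' : (N : ℝ) ≤ k := by exact_mod_cast hk
    have e : C ^ (2 * k) = Real.exp (2 * k * Real.log C) := by
      rw [← Real.exp_log hC0, ← Real.exp_nat_mul]; push_cast; rw [Real.log_exp]
    rw [e, ← Real.exp_add]
    refine Real.exp_le_exp.2 ?_
    nlinarith [(Nat.cast_nonneg k : (0 : ℝ) ≤ k)]
  simpa using h2.const_mul D

/-- The Gaussian sits at distance k from the origin. The Harnack chain loses at most C^(2k) on the
way there, and the normalised source on the ball of radius k/2 is bounded by C^(2k) exp(−k²/4) up to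
a constant. -/
theorem exists_approximations [NeZero m] (hn : 0 < n) (hK : KernelCondition K)
    (hB : HarnackCondition K) (hS : IsStableCooperative K B A) (hB0 : 0 ≤ B) :
    ∃ (Λ C : ℝ) (δ : ℕ → ℝ) (u U : ℕ → Fin m → Rn n → ℝ) (s : ℕ → Rn n → ℝ), 0 ≤ Λ ∧ 1 ≤ C ∧
      Tendsto δ atTop (𝓝 0) ∧
      ∀ k : ℕ, IsApproximation K A Λ C (1 / ((k : ℝ) + 1)) (δ k) k (u k) (U k) (s k) := by
  set C₀ := (∫ y, ‖y‖ ^ 2 * K y) + m * B + 1 with hC₀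
  have hC₀0 : 0 ≤ C₀ := by have := hK.moment_nonneg; positivity
  set Λ := B + 1 + C₀ with hΛ
  have hΛ0 : 0 ≤ Λ := by positivity
  obtain ⟨C, hC1, hchain⟩ := hB.exists_chain hK (m * Λ)
  have hCpos : 0 < C := by linarith
  set δ : ℕ → ℝ := fun k => C₀ * Real.exp 1 * (C ^ (2 * k) * Real.exp (-((k : ℝ) / 2) ^ 2))
    + 1 / ((k : ℝ) + 1) with hδ
  have hδlim : Tendsto δ atTop (𝓝 0) := by
    have h := (tendsto_pow_mul_exp_neg_sq C (C₀ * Real.exp 1) hC1).add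
      (tendsto_one_div_add_atTop_nhds_zero_nat (𝕜 := ℝ))
    rwa [add_zero] at h
  suffices h : ∀ k : ℕ, ∃ (u U : Fin m → Rn n → ℝ) (s : Rn n → ℝ),
      IsApproximation K A Λ C (1 / ((k : ℝ) + 1)) (δ k) k u U s by
    choose u U s h using h
    exact ⟨Λ, C, δ, u, U, s, hΛ0, hC1, hδlim, h⟩
  intro k
  have hk : (0 : ℝ) < 1 / ((k : ℝ) + 1) := by positivity
  have hk1 : (1 : ℝ) / ((k : ℝ) + 1) ≤ 1 := by
    rw [div_le_one (by positivity)]; linarith [(Nat.cast_nonneg k : (0 : ℝ) ≤ k)]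
  set a : Rn n := EuclideanSpace.single (⟨0, hn⟩ : Fin n) (k : ℝ) with ha
  have hanorm : ‖a‖ = k := by simp [ha]
  obtain ⟨u, hug, hweak⟩ := exists_solution_gaussian_source hK hS hk hk1 a
  have hu0 : ∀ i x, 0 ≤ u i x := fun i x => (gaussianAt_pos a x).le.trans (hug i x)
  have huL : ∀ i, LocallyIntegrable (u i) := fun i => (hweak i).left
  have hUC : ∀ j i, ContDiff ℝ 2 (mollify j (u i)) := fun j i => contDiff_two_mollify j (huL i)
  have hU0 : ∀ j i x, 0 ≤ mollify j (u i) x := fun j i x => mollify_nonneg j (hu0 i) x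
  have hsumL : LocallyIntegrable (fun x => ∑ i, u i x) := by
    have := locallyIntegrable_finsetSum (μ := (volume : Measure (Rn n))) Finset.univ
      (fun i _ => huL i)
    refine this.congr (Eventually.of_forall fun x => ?_)
    simp
  have hop : ∀ j i x, |nonlocalOp K (mollify j (u i)) x| ≤ Λ * ∑ l, mollify j (u l) x := by
    intro j i x
    rw [(hweak i).nonlocalOp_mollify hK j x, ← mollify_sum _ j huL, ← mollify_const_mul]
    exact abs_mollify_le j (hweak i).right (hsumL.smul Λ)
      (fun z => abs_rhs_le hS hk hk1 hC₀0 (gaussianAt_pos a z).le fun l => hug l z) x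
  have hharn : ∀ (j N : ℕ) (x y : Rn n), dist x y ≤ N / 2 →
      ∑ i, mollify j (u i) x ≤ C ^ N * ∑ i, mollify j (u i) y := by
    intro j
    refine hchain (fun x => ∑ i, mollify j (u i) x) (ContDiff.sum fun i _ => hUC j i)
      (fun x => Finset.sum_nonneg fun i _ => hU0 j i x) fun x => ?_
    rw [hK.nonlocalOp_sum _ fun i => hUC j i]
    refine (Finset.abs_sum_le_sum_abs _ _).trans ((Finset.sum_le_sum fun i _ => hop j i x).trans
      (le_of_eq ?_))
    simp [mul_assoc]
  -- The Gaussian is at least e⁻¹ on the unit ball about a, which contains the support of the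
  -- mollifier; a chain of 2k half-unit steps leads from a to the origin.
  have hlow : ∀ j, Real.exp (-1) ≤ C ^ (2 * k) * ∑ i, mollify j (u i) 0 := by
    intro j
    have h1 : Real.exp (-1) ≤ mollify j (u 0) a := le_mollify j (huL 0) fun z hz => by
      refine le_trans (Real.exp_le_exp.2 ?_) (hug 0 z)
      rw [dist_eq_norm] at hz
      nlinarith [norm_nonneg (z - a)]
    refine (h1.trans (Finset.single_le_sum (f := fun i => mollify j (u i) a)
      (fun i _ => hU0 j i a) (Finset.mem_univ 0))).trans (hharn j _ _ _ ?_)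
    rw [dist_zero_right, hanorm]; push_cast; linarith
  have hCk : 0 < C ^ (2 * k) := by positivity
  -- This tolerance is at most S/(k + 1) for the normalising sum S introduced below, so after
  -- division by S the error is at most 1/(k + 1).
  have hε : 0 < Real.exp (-1) / C ^ (2 * k) * (1 / ((k : ℝ) + 1)) := by positivity
  obtain ⟨j, hj⟩ := exists_mollify_close huL hu0 hharn k hε
  set S := ∑ i, mollify j (u i) 0 with hSdef
  have hSlow : Real.exp (-1) / C ^ (2 * k) ≤ S := by
    rw [div_le_iff₀ hCk, mul_comm]; exact hlow j
  have hS0 : 0 < S := lt_of_lt_of_le (by positivity) hSlow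
  have hSinv : S⁻¹ ≤ Real.exp 1 * C ^ (2 * k) := by
    rw [inv_le_comm₀ hS0 (by positivity), mul_inv, ← Real.exp_neg]
    exact hSlow
  refine ⟨fun i x => S⁻¹ * u i x, fun i x => S⁻¹ * mollify j (u i) x,
    fun x => S⁻¹ * (C₀ * gaussianAt a x), ?_⟩
  have hSi : 0 ≤ S⁻¹ := (inv_pos.2 hS0).le
  refine ⟨fun i => ?_, fun i => contDiff_const.mul (hUC j i), fun i x => mul_nonneg hSi (hU0 j i x),
    ?_, fun i x => ?_, fun N x y hxy => ?_, ?_, fun x => ?_, fun x hx => ?_, fun i => ?_⟩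
  · convert (hweak i).const_mul S⁻¹ using 1
    ext x
    rw [mul_add, mul_sub, Finset.mul_sum]
    congr 1
    congr 1
    · exact Finset.sum_congr rfl fun j _ => by ring
    · ring
  · rw [← Finset.mul_sum]; exact inv_mul_cancel₀ hS0.ne'
  · rw [nonlocalOp_const_mul, ← Finset.mul_sum, abs_mul, abs_of_nonneg hSi]
    calc _ ≤ S⁻¹ * (Λ * ∑ l, mollify j (u l) x) := mul_le_mul_of_nonneg_left (hop j i x) hSi
      _ = _ := by ring
  · rw [← Finset.mul_sum, ← Finset.mul_sum]
    calc _ ≤ S⁻¹ * (C ^ N * ∑ i, mollify j (u i) y) :=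
          mul_le_mul_of_nonneg_left (hharn j N x y hxy) hSi
      _ = _ := by ring
  · exact ((contDiff_gaussianAt a).continuous.const_mul C₀).const_mul S⁻¹
  · exact mul_nonneg hSi (mul_nonneg hC₀0 (gaussianAt_pos a x).le)
  · have h1 : (k : ℝ) / 2 ≤ ‖x - a‖ := by
      have := norm_sub_norm_le a x
      rw [norm_sub_rev, hanorm] at this
      linarith
    have h2 : gaussianAt a x ≤ Real.exp (-((k : ℝ) / 2) ^ 2) := by
      refine Real.exp_le_exp.2 (neg_le_neg (pow_le_pow_left₀ (by positivity) h1 2))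
    calc S⁻¹ * (C₀ * gaussianAt a x)
        ≤ (Real.exp 1 * C ^ (2 * k)) * (C₀ * Real.exp (-((k : ℝ) / 2) ^ 2)) := by
          exact mul_le_mul hSinv (mul_le_mul_of_nonneg_left h2 hC₀0)
            (mul_nonneg hC₀0 (gaussianAt_pos a x).le) (by positivity)
      _ = C₀ * Real.exp 1 * (C ^ (2 * k) * Real.exp (-((k : ℝ) / 2) ^ 2)) := by ring
      _ ≤ δ k := le_add_of_nonneg_right hk.le
  · have e : ∀ x, |S⁻¹ * u i x - S⁻¹ * mollify j (u i) x| = S⁻¹ * |u i x - mollify j (u i) x| := by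
      intro x; rw [← mul_sub, abs_mul, abs_of_nonneg hSi]
    simp only [e, integral_const_mul]
    calc S⁻¹ * ∫ x in Metric.closedBall 0 (k : ℝ), |u i x - mollify j (u i) x|
        ≤ S⁻¹ * (Real.exp (-1) / C ^ (2 * k) * (1 / ((k : ℝ) + 1))) :=
          mul_le_mul_of_nonneg_left (hj i) hSi
      _ ≤ S⁻¹ * (S * (1 / ((k : ℝ) + 1))) :=
          mul_le_mul_of_nonneg_left (mul_le_mul_of_nonneg_right hSlow hk.le) hSi
      _ = 1 / ((k : ℝ) + 1) := inv_mul_cancel_left₀ hS0.ne' _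
      _ ≤ δ k := le_add_of_nonneg_left (mul_nonneg (mul_nonneg hC₀0 (Real.exp_pos 1).le)
          (mul_nonneg hCk.le (Real.exp_pos _).le))

end Approximation

/-! ### The strong maximum principle -/

section StrongMaximum

variable {n : ℕ} {K : Rn n → ℝ}

/-- If K vanished almost everywhere, L would be zero and ‖x‖ would be a nonnegative solution with a
zero at the origin only, against (B). -/
theorem HarnackCondition.volume_ne_zero (hn : 0 < n) (hB : HarnackCondition K) :
    volume {y : Rn n | K y ≠ 0} ≠ 0 := by
  intro h0
  have hK0 : ∀ᵐ y : Rn n, K y = 0 := h0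
  obtain ⟨C, -, hH⟩ := hB 0
  have hL : ∀ (η : Rn n → ℝ) (x : Rn n), nonlocalOp K η x = 0 := by
    intro η x
    rw [nonlocalOp, integral_eq_zero_of_ae, mul_zero]
    filter_upwards [hK0] with y hy
    simp [hy]
  have h1 := hH (fun x => ‖x‖) (fun _ => 0) measurable_const (by simp) (fun x => norm_nonneg x)
    ⟨continuous_norm, by simpa using locallyIntegrable_const (0 : ℝ), fun η _ => by simp [hL]⟩
    0 (EuclideanSpace.single (⟨0, hn⟩ : Fin n) (1 / 2)) (by simp; norm_num) 0 (by simp)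
  simp at h1
  norm_num at h1

theorem secondDiff_norm_sq (a x y : Rn n) :
    secondDiff (fun z => ‖z - a‖ ^ 2) x y = -2 * ‖y‖ ^ 2 := by
  have h := parallelogram_law_with_norm ℝ (x - a) y
  rw [show x - a + y = x + y - a by abel, show x - a - y = x - y - a by abel] at h
  simp only [secondDiff]
  linarith

theorem nonlocalOp_norm_sq (K : Rn n → ℝ) (a x : Rn n) :
    nonlocalOp K (fun z => ‖z - a‖ ^ 2) x = -∫ y, ‖y‖ ^ 2 * K y := by
  simp only [nonlocalOp_eq_secondDiff, secondDiff_norm_sq, mul_assoc, integral_const_mul]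
  ring

theorem contDiff_norm_sub_sq (a : Rn n) : ContDiff ℝ 2 (fun z : Rn n => ‖z - a‖ ^ 2) :=
  (contDiff_id.sub contDiff_const).norm_sq ℝ

/-- A penalised nonnegative function has a minimum point. -/
theorem exists_penalised_min {v : Rn n → ℝ} (hv : Continuous v) (hv0 : ∀ x, 0 ≤ v x) {κ : ℝ}
    (hκ : 0 < κ) (a : Rn n) :
    ∃ x, ∀ z, v x + κ * ‖x - a‖ ^ 2 ≤ v z + κ * ‖z - a‖ ^ 2 := by
  have hc : Continuous (fun x => v x + κ * ‖x - a‖ ^ 2) := by fun_prop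
  refine hc.exists_forall_le' a (mem_cocompact.2 ⟨Metric.closedBall a (v a / κ + 1),
    isCompact_closedBall _ _, fun x hx => ?_⟩)
  have h1 : v a / κ + 1 < ‖x - a‖ := by simpa [dist_eq_norm] using hx
  have h2 : 0 ≤ v a / κ := div_nonneg (hv0 a) hκ.le
  have h3 : v a / κ ≤ ‖x - a‖ ^ 2 := by nlinarith
  have h4 : v a ≤ κ * ‖x - a‖ ^ 2 := by rwa [div_le_iff₀' hκ] at h3
  simp only [Set.mem_ofPred_eq, sub_self, norm_zero]
  linarith [hv0 x]

/-- At a zero of a nonnegative supersolution, the nonlocal average over the kernel vanishes. -/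
theorem IsWeakSolution.ae_eq_zero_of_zero (hK : KernelCondition K) {f F : Rn n → ℝ} {B : ℝ}
    (hB : 0 ≤ B) (hf : Continuous f) (hf0 : ∀ x, 0 ≤ f x) (h : IsWeakSolution K f F)
    (hF : ∀ x, -(B * f x) ≤ F x) {a : Rn n} (ha : f a = 0) :
    ∀ᵐ y, (f (a + y) + f (a - y)) * K y = 0 := by
  set V : ℕ → Rn n → ℝ := fun j => mollify j f with hV
  have hVC : ∀ j, ContDiff ℝ 2 (V j) := fun j => contDiff_two_mollify j h.left
  have hV0 : ∀ j x, 0 ≤ V j x := fun j x => mollify_nonneg j hf0 x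
  have hLV : ∀ j x, -(B * V j x) ≤ nonlocalOp K (V j) x := by
    intro j x
    rw [h.nonlocalOp_mollify hK j x, ← neg_mul, ← mollify_const_mul]
    exact mollify_mono j (h.left.smul (-B)) h.right (fun z => by simpa using hF z) x
  set s : ℕ → ℝ := fun j => V j a with hs
  have hslim : Tendsto s atTop (𝓝 0) := by
    have := tendsto_mollify_of_continuous hf (tendsto_const_nhds (x := a))
    rwa [ha] at this
  -- The penalty must tend to zero, yet slowly enough that s/κ ≤ √s also does, which forces the
  -- minimum points to converge to a. The second summand keeps it positive.
  set κ : ℕ → ℝ := fun j => √(s j) + 1 / ((j : ℝ) + 1) with hκ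
  have hκ0 : ∀ j, 0 < κ j := fun j => by positivity
  have hsqlim : Tendsto (fun j => √(s j)) atTop (𝓝 0) := by
    have := (Real.continuous_sqrt.tendsto 0).comp hslim
    rwa [Real.sqrt_zero] at this
  have hκlim : Tendsto κ atTop (𝓝 0) := by
    have := hsqlim.add (tendsto_one_div_add_atTop_nhds_zero_nat (𝕜 := ℝ))
    rwa [add_zero] at this
  choose x hx using fun j => exists_penalised_min (hVC j).continuous (hV0 j) (hκ0 j) a
  have hxa : ∀ j, V j (x j) + κ j * ‖x j - a‖ ^ 2 ≤ s j := fun j => by simpa using hx j a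
  have hxlim : Tendsto x atTop (𝓝 a) := by
    rw [tendsto_iff_norm_sub_tendsto_zero]
    have h1 : Tendsto (fun j => ‖x j - a‖ ^ 2) atTop (𝓝 0) := by
      refine squeeze_zero (fun j => by positivity) (fun j => ?_) hsqlim
      have h2 : κ j * ‖x j - a‖ ^ 2 ≤ κ j * √(s j) := by
        have h3 : √(s j) * √(s j) = s j := Real.mul_self_sqrt (hV0 j a)
        have h4 : √(s j) * √(s j) ≤ κ j * √(s j) :=
          mul_le_mul_of_nonneg_right (le_add_of_nonneg_right (by positivity)) (Real.sqrt_nonneg _)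
        linarith [hxa j, hV0 j (x j)]
      exact le_of_mul_le_mul_left h2 (hκ0 j)
    have h2 := (Real.continuous_sqrt.tendsto 0).comp h1
    simpa [Function.comp_def, Real.sqrt_sq (norm_nonneg _)] using h2
  set g : ℕ → Rn n → ℝ := fun j z => V j z + κ j * ‖z - a‖ ^ 2 with hg
  have hgC : ∀ j, ContDiff ℝ 2 (g j) := fun j =>
    (hVC j).add (contDiff_const.mul (contDiff_norm_sub_sq a))
  have hLg : ∀ j, -(B * s j + κ j * ∫ y, ‖y‖ ^ 2 * K y) ≤ nonlocalOp K (g j) (x j) := by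
    intro j
    have h1 : nonlocalOp K (g j) (x j) = nonlocalOp K (V j) (x j) - κ j * ∫ y, ‖y‖ ^ 2 * K y := by
      rw [hg, hK.nonlocalOp_add (hVC j) (contDiff_const.mul (contDiff_norm_sub_sq a)),
        nonlocalOp_const_mul, nonlocalOp_norm_sq]
      ring
    have h2 : V j (x j) ≤ s j := by
      have : 0 ≤ κ j * ‖x j - a‖ ^ 2 := mul_nonneg (hκ0 j).le (by positivity)
      linarith [hxa j]
    have h3 := hLV j (x j)
    have h4 : B * V j (x j) ≤ B * s j := mul_le_mul_of_nonneg_left h2 hB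
    rw [h1]; linarith
  -- Second differences at a global minimum are nonpositive, so w ≥ 0 and Fatou applies. The
  -- supersolution inequality at the minimum point makes the integrals of w tend to zero.
  set w : ℕ → Rn n → ℝ := fun j y => -(secondDiff (g j) (x j) y * K y) with hw
  have hw0 : ∀ j y, 0 ≤ w j y := by
    intro j y
    have h1 := hx j (x j + y)
    have h2 := hx j (x j - y)
    have h3 : secondDiff (g j) (x j) y ≤ 0 := by simp only [secondDiff, hg]; linarith
    exact neg_nonneg.2 (mul_nonpos_of_nonpos_of_nonneg h3 (hK.nonneg y))
  have hwi : ∀ j, Integrable (w j) := fun j => (hK.integrable_secondDiff (hgC j) (x j)).neg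
  have hwint : ∀ j, ∫ y, w j y ≤ 2 * (B * s j + κ j * ∫ y, ‖y‖ ^ 2 * K y) := by
    intro j
    have h1 := hLg j
    rw [nonlocalOp_eq_secondDiff] at h1
    simp only [hw, integral_neg]
    linarith
  have hglim : ∀ z, Tendsto (fun j => g j (x j + z)) atTop (𝓝 (f (a + z))) := by
    intro z
    have hxz : Tendsto (fun j => x j + z) atTop (𝓝 (a + z)) := hxlim.add_const z
    have h1 := tendsto_mollify_of_continuous hf hxz
    have h2 := hκlim.mul ((hxz.sub_const a).norm.pow 2)
    rw [zero_mul] at h2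
    simpa using h1.add h2
  have hwlim : ∀ y, Tendsto (fun j => w j y) atTop (𝓝 ((f (a + y) + f (a - y)) * K y)) := by
    intro y
    have h0 := hglim 0
    have h1 := hglim y
    have h2 := hglim (-y)
    simp only [add_zero, ha, ← sub_eq_add_neg] at h0 h1 h2
    have h3 := ((((h0.const_mul 2).sub h1).sub h2).mul_const (K y)).neg
    rwa [show -((2 * 0 - f (a + y) - f (a - y)) * K y) = (f (a + y) + f (a - y)) * K y by ring]
      at h3
  have hfatou : ∫⁻ y, ENNReal.ofReal ((f (a + y) + f (a - y)) * K y) = 0 := by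
    refine le_antisymm ?_ zero_le
    calc ∫⁻ y, ENNReal.ofReal ((f (a + y) + f (a - y)) * K y)
        = ∫⁻ y, liminf (fun j => ENNReal.ofReal (w j y)) atTop := by
          congr 1; ext y
          exact ((ENNReal.continuous_ofReal.tendsto _).comp (hwlim y)).liminf_eq.symm
      _ ≤ liminf (fun j => ∫⁻ y, ENNReal.ofReal (w j y)) atTop :=
          lintegral_liminf_le' fun j => (hwi j).aemeasurable.ennreal_ofReal
      _ ≤ liminf (fun j => ENNReal.ofReal (2 * (B * s j + κ j * ∫ y, ‖y‖ ^ 2 * K y))) atTop := by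
          refine liminf_le_liminf (Eventually.of_forall fun j => ?_)
          rw [← ofReal_integral_eq_lintegral_ofReal (hwi j) (Eventually.of_forall (hw0 j))]
          exact ENNReal.ofReal_le_ofReal (hwint j)
      _ = 0 := by
          have h1 := ((hslim.const_mul B).add (hκlim.mul_const (∫ y, ‖y‖ ^ 2 * K y))).const_mul 2
          simp only [mul_zero, zero_mul, add_zero] at h1
          have h2 := ((ENNReal.continuous_ofReal.tendsto _).comp h1).liminf_eq
          rw [ENNReal.ofReal_zero] at h2
          exact h2
  have hmeas : AEMeasurable (fun y => ENNReal.ofReal ((f (a + y) + f (a - y)) * K y)) := by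
    have hc : Continuous (fun y => f (a + y) + f (a - y)) := by fun_prop
    exact (hc.measurable.mul hK.measurable).ennreal_ofReal.aemeasurable
  rw [lintegral_eq_zero_iff' hmeas] at hfatou
  filter_upwards [hfatou] with y hy
  exact le_antisymm (ENNReal.ofReal_eq_zero.1 hy)
    (mul_nonneg (add_nonneg (hf0 _) (hf0 _)) (hK.nonneg y))

open scoped Pointwise in
/-- A nonnegative continuous supersolution that vanishes somewhere vanishes identically. -/
theorem IsWeakSolution.eq_zero_of_exists_zero (hK : KernelCondition K)
    (hKpos : volume {y : Rn n | K y ≠ 0} ≠ 0) {f F : Rn n → ℝ} {B : ℝ}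
    (hB : 0 ≤ B) (hf : Continuous f) (hf0 : ∀ x, 0 ≤ f x) (h : IsWeakSolution K f F)
    (hF : ∀ x, -(B * f x) ≤ F x) {a : Rn n} (ha : f a = 0) (x : Rn n) : f x = 0 := by
  set E : Set (Rn n) := {y | K y ≠ 0} with hE
  -- On this closed essential support of the kernel, continuity of f upgrades the almost everywhere
  -- vanishing to vanishing at every point.
  set S : Set (Rn n) := (volume.restrict E).support with hS
  set Z : Set (Rn n) := {x | f x = 0} with hZ
  have hZc : IsClosed Z := isClosed_eq hf continuous_const
  have key : ∀ z ∈ Z, ∀ y ∈ S, f (z + y) + f (z - y) = 0 := by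
    intro z hz y hy
    by_contra hne
    have hopen : IsOpen {y | f (z + y) + f (z - y) ≠ 0} :=
      isOpen_ne_fun (by fun_prop) continuous_const
    have h1 := (Measure.mem_support_iff_forall y).1 hy _ (hopen.mem_nhds hne)
    refine h1.ne' ?_
    rw [Measure.restrict_apply hopen.measurableSet]
    refine measure_mono_null ?_ (h.ae_eq_zero_of_zero hK hB hf hf0 hF hz)
    rintro w ⟨hw1, hw2⟩
    exact mul_ne_zero hw1 hw2
  have hadd : ∀ z ∈ Z, ∀ y ∈ S, z + y ∈ Z := fun z hz y hy => by
    have := key z hz y hy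
    exact le_antisymm (by linarith [hf0 (z - y)]) (hf0 _)
  have hsub : ∀ z ∈ Z, ∀ y ∈ S, z - y ∈ Z := fun z hz y hy => by
    have := key z hz y hy
    exact le_antisymm (by linarith [hf0 (z + y)]) (hf0 _)
  have hSpos : 0 < volume S := by
    have h1 : volume.restrict E Sᶜ = 0 := Measure.measure_compl_support
    rw [Measure.restrict_apply Measure.isClosed_support.measurableSet.compl] at h1
    rw [pos_iff_ne_zero]
    intro h2
    refine hKpos (measure_mono_null (fun y hy => ?_) (measure_union_null h1 h2))
    by_cases hyS : y ∈ S
    · exact Or.inr hyS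
    · exact Or.inl ⟨hyS, hy⟩
  -- Steinhaus: S − S is a neighbourhood of 0. The zero set is stable under adding and subtracting
  -- elements of S, hence open, and connectedness finishes.
  have hnhds := Measure.sub_mem_nhds_zero_of_addHaar_pos volume S
    Measure.isClosed_support.measurableSet hSpos
  have hZo : IsOpen Z := by
    rw [isOpen_iff_mem_nhds]
    intro z hz
    have h1 : (fun w => w - z) ⁻¹' (S - S) ∈ 𝓝 z := by
      refine ContinuousAt.preimage_mem_nhds (by fun_prop) ?_
      rwa [sub_self]
    filter_upwards [h1] with w hw
    obtain ⟨p, hp, q, hq, hpq⟩ := Set.mem_sub.1 hw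
    have hpq' : p - q = w - z := hpq
    have e : w = z + p - q := by rw [add_sub_assoc, hpq', add_sub_cancel]
    rw [e]
    exact hsub _ (hadd _ hz p hp) q hq
  have hun : Z = Set.univ := IsClopen.eq_univ ⟨hZc, hZo⟩ ⟨a, ha⟩
  exact hun.symm.subset (Set.mem_univ x)

end StrongMaximum

/-! ### Passage to the limit -/

section Limit

variable {n m : ℕ} {K : Rn n → ℝ} {B : ℝ} {A : Rn n → Matrix (Fin m) (Fin m) ℝ}

theorem abs_integral_mul_le {h ψ : Rn n → ℝ} (hh : LocallyIntegrable h) {C R : ℝ}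
    (hb : ∀ x, |ψ x| ≤ C) (hz : ∀ x, R < ‖x‖ → ψ x = 0) :
    |∫ x, h x * ψ x| ≤ C * ∫ x in Metric.closedBall 0 R, |h x| := by
  have h1 : ∫ x, h x * ψ x = ∫ x in Metric.closedBall 0 R, h x * ψ x := by
    refine (setIntegral_eq_integral_of_forall_compl_eq_zero fun x hx => ?_).symm
    rw [hz x (by simpa using hx), mul_zero]
  rw [h1, ← integral_const_mul, ← Real.norm_eq_abs]
  refine norm_integral_le_of_norm_le
    ((hh.integrableOn_isCompact (isCompact_closedBall _ _)).abs.const_mul C)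
    (Eventually.of_forall fun x => ?_)
  rw [norm_mul, mul_comm]
  exact mul_le_mul_of_nonneg_right (hb x) (norm_nonneg _)

theorem integrable_mul_of_bounded_support {h ψ : Rn n → ℝ} (hh : LocallyIntegrable h)
    (hψ : Measurable ψ) {C R : ℝ} (hb : ∀ x, |ψ x| ≤ C) (hz : ∀ x, R < ‖x‖ → ψ x = 0) :
    Integrable (fun x => h x * ψ x) := by
  have h1 : Integrable ((Metric.closedBall (0 : Rn n) R).indicator h) :=
    (integrable_indicator_iff measurableSet_closedBall).2
      (hh.integrableOn_isCompact (isCompact_closedBall _ _))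
  refine (h1.mul_bdd (c := C) hψ.aestronglyMeasurable (Eventually.of_forall hb)).congr
    (Eventually.of_forall fun x => ?_)
  by_cases hx : ‖x‖ ≤ R
  · simp [Set.indicator_of_mem (show x ∈ Metric.closedBall (0 : Rn n) R by simpa using hx)]
  · simp [hz x (not_le.1 hx)]

theorem tendsto_integral_mul {l : Filter ℕ} {f : ℕ → Rn n → ℝ} {g ψ : Rn n → ℝ}
    (hf : ∀ k, LocallyIntegrable (f k)) (hg : LocallyIntegrable g)
    (hlim : ∀ R : ℝ, Tendsto (fun k => ∫ x in Metric.closedBall 0 R, |f k x - g x|) l (𝓝 0))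
    (hψ : Measurable ψ) {C R : ℝ} (hb : ∀ x, |ψ x| ≤ C) (hz : ∀ x, R < ‖x‖ → ψ x = 0) :
    Tendsto (fun k => ∫ x, f k x * ψ x) l (𝓝 (∫ x, g x * ψ x)) := by
  rw [tendsto_iff_dist_tendsto_zero]
  have h1 := (hlim R).const_mul C
  rw [mul_zero] at h1
  refine squeeze_zero (fun k => dist_nonneg) (fun k => ?_) h1
  rw [Real.dist_eq, ← integral_sub (integrable_mul_of_bounded_support (hf k) hψ hb hz)
    (integrable_mul_of_bounded_support hg hψ hb hz)]
  simp only [← sub_mul]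
  exact abs_integral_mul_le ((hf k).sub hg) hb hz

theorem IsApproximation.sum_le {Λ C μ δ R : ℝ} {u U : Fin m → Rn n → ℝ} {s : Rn n → ℝ}
    (h : IsApproximation K A Λ C μ δ R u U s) {N : ℕ} {x : Rn n} (hx : ‖x‖ ≤ N / 2) :
    ∑ i, U i x ≤ C ^ N := by
  simpa [h.normalised] using h.harnack N x 0 (by simpa using hx)

theorem IsApproximation.le_pow {Λ C μ δ R : ℝ} {u U : Fin m → Rn n → ℝ} {s : Rn n → ℝ}
    (h : IsApproximation K A Λ C μ δ R u U s) {N : ℕ} {x : Rn n} (hx : ‖x‖ ≤ N / 2) (i : Fin m) :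
    U i x ≤ C ^ N :=
  (Finset.single_le_sum (f := fun i => U i x) (fun i _ => h.nonneg i x) (Finset.mem_univ i)).trans
    (h.sum_le hx)

/-- Normalisation at the origin and Harnack chains bound U and LU locally, uniformly in k; the local
Hölder estimate then gives a common modulus of continuity. -/
theorem equicontinuous_approximations (hK : KernelCondition K) (hC : HolderCondition K)
    {Λ C : ℝ} (hΛ : 0 ≤ Λ) {μ δ R : ℕ → ℝ} {u U : ℕ → Fin m → Rn n → ℝ} {s : ℕ → Rn n → ℝ}
    (h : ∀ k, IsApproximation K A Λ C (μ k) (δ k) (R k) (u k) (U k) (s k)) (i : Fin m) :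
    Equicontinuous fun k => U k i := by
  obtain ⟨α, D, hα, hD, hloc⟩ := hC.exists_local hK
  intro x₀
  -- The radius 3 is the one on which the local Hölder estimate needs a bound; N chain steps reach
  -- all of that ball from the origin.
  obtain ⟨N, hN⟩ := exists_nat_ge (2 * (‖x₀‖ + 3))
  have hball : ∀ x, dist x x₀ < 3 → ‖x‖ ≤ N / 2 := by
    intro x hx
    have := norm_le_norm_add_norm_sub x₀ x
    rw [dist_eq_norm, norm_sub_rev] at hx
    rw [norm_sub_rev] at this
    linarith [norm_sub_rev x x₀]
  refine Metric.equicontinuousAt_of_continuity_modulus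
    (fun x => D * (Λ * C ^ N + C ^ N) * dist x₀ x ^ α) ?_ _ ?_
  · have h1 : Tendsto (fun x => dist x₀ x ^ α) (𝓝 x₀) (𝓝 (dist x₀ x₀ ^ α)) :=
      ((continuous_const.dist continuous_id).tendsto x₀).rpow_const (Or.inr hα.le)
    rw [dist_self, Real.zero_rpow hα.ne'] at h1
    simpa using h1.const_mul (D * (Λ * C ^ N + C ^ N))
  · filter_upwards [Metric.ball_mem_nhds x₀ (by norm_num : (0 : ℝ) < 1 / 2)] with x hx k
    rw [Real.dist_eq]
    refine hloc (U k i) ((h k).smooth i) x₀ (C ^ N) (Λ * C ^ N) (fun z hz => ?_) (fun z hz => ?_)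
      x₀ x (by simp) hx
    · rw [abs_of_nonneg ((h k).nonneg i z)]
      exact (h k).le_pow (hball z hz) i
    · exact ((h k).op_bound i z).trans
        (mul_le_mul_of_nonneg_left ((h k).sum_le (hball z (by linarith))) hΛ)

theorem tendsto_setIntegral_abs_sub {l : Filter ℕ} {f : ℕ → Rn n → ℝ} {g : Rn n → ℝ} {R : ℝ}
    (h : TendstoUniformlyOn f g l (Metric.closedBall 0 R)) :
    Tendsto (fun k => ∫ x in Metric.closedBall 0 R, |f k x - g x|) l (𝓝 0) := by
  rw [Metric.tendsto_nhds]
  intro ε hε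
  set V := volume.real (Metric.closedBall (0 : Rn n) R) with hV
  have hV0 : 0 ≤ V := measureReal_nonneg
  filter_upwards [Metric.tendstoUniformlyOn_iff.1 h (ε / (V + 1)) (by positivity)] with k hk
  rw [Real.dist_eq, sub_zero]
  have h1 : ‖∫ x in Metric.closedBall 0 R, |f k x - g x|‖ ≤ ε / (V + 1) * V :=
    norm_setIntegral_le_of_norm_le_const (isCompact_closedBall (0 : Rn n) R).measure_lt_top
      fun x hx => by
        have := (hk x hx).le
        rw [dist_comm, Real.dist_eq] at this
        simpa using this
  refine lt_of_le_of_lt h1 ?_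
  rw [div_mul_eq_mul_div, div_lt_iff₀ (by positivity)]
  nlinarith

/-- An equicontinuous, pointwise bounded sequence converges locally uniformly along an ultrafilter. -/
theorem exists_ultrafilter_limit {U : ℕ → Rn n → ℝ} (hU : Equicontinuous U)
    (hb : ∀ x, ∃ M, ∀ k, |U k x| ≤ M) (l : Ultrafilter ℕ) :
    ∃ φ : Rn n → ℝ, Continuous φ ∧ (∀ x, Tendsto (fun k => U k x) l (𝓝 (φ x))) ∧
      ∀ R, TendstoUniformlyOn U φ l (Metric.closedBall 0 R) := by
  have hpt : ∀ x, ∃ y, Tendsto (fun k => U k x) l (𝓝 y) := by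
    intro x
    obtain ⟨M, hM⟩ := hb x
    obtain ⟨y, -, hy⟩ := (isCompact_Icc (a := -M) (b := M)).ultrafilter_le_nhds
      (l.map fun k => U k x) 
        (tendsto_principal.2 (Eventually.of_forall fun k => abs_le.1 (hM k)))
    exact ⟨y, hy⟩
  choose φ hφ using hpt
  refine ⟨φ, Tendsto.continuous_of_equicontinuous (tendsto_pi_nhds.2 hφ) hU, hφ, fun R => ?_⟩
  have h := (EquicontinuousOn.tendsto_uniformOnFun_iff_pi (F := U)
    (𝔖 := {Q : Set (Rn n) | IsCompact Q}) (fun Q hQ => hQ)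
    (Set.sUnion_eq_univ_iff.2 fun x => ⟨{x}, isCompact_singleton, rfl⟩)
    (fun Q _ => hU.equicontinuousOn Q) l φ).2 (tendsto_pi_nhds.2 hφ)
  exact UniformOnFun.tendsto_iff_tendstoUniformlyOn.1 h _ (isCompact_closedBall _ _)

/-- A stable cooperative system has a nontrivial nonnegative continuous solution. -/
theorem exists_nonneg_solution [NeZero m] (hn : 0 < n) (hK : KernelCondition K)
    (hB : HarnackCondition K) (hC : HolderCondition K) (hS : IsStableCooperative K B A)
    (hB0 : 0 ≤ B) :
    ∃ φ : Fin m → Rn n → ℝ, (∀ i, Continuous (φ i)) ∧ (∀ i x, 0 ≤ φ i x) ∧ ∑ i, φ i 0 = 1 ∧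
      ∀ i, IsWeakSolution K (φ i) (fun x => ∑ j, A x i j * φ j x) := by
  obtain ⟨Λ, C, δ, u, U, s, hΛ, hC1, hδ, hap⟩ := exists_approximations hn hK hB hS hB0
  -- Limits along a nonprincipal ultrafilter replace the extraction of a common subsequence for all
  -- components.
  set l : Ultrafilter ℕ := hyperfilter ℕ with hl
  have hle : (l : Filter ℕ) ≤ atTop := Nat.hyperfilter_le_atTop
  have hlim : ∀ i, ∃ φ : Rn n → ℝ, Continuous φ ∧
      (∀ x, Tendsto (fun k => U k i x) l (𝓝 (φ x))) ∧
      ∀ R, TendstoUniformlyOn (fun k => U k i) φ l (Metric.closedBall 0 R) := fun i =>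
    exists_ultrafilter_limit (equicontinuous_approximations hK hC hΛ hap i) (fun x => by
      obtain ⟨N, hN⟩ := exists_nat_ge (2 * ‖x‖)
      refine ⟨C ^ N, fun k => ?_⟩
      rw [abs_of_nonneg ((hap k).nonneg i x)]
      exact (hap k).le_pow (by linarith) i) l
  choose φ hφc hφ hφu using hlim
  -- The estimates hold for the smooth U, the system for u, since mollification does not commute
  -- with the coefficients A. Closeness in L¹ transfers the limit from U to u.
  have hL1 : ∀ i (R : ℝ),
      Tendsto (fun k => ∫ x in Metric.closedBall 0 R, |u k i x - φ i x|) l (𝓝 0) := by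
    intro i R
    have h1 := (hδ.mono_left hle).add (tendsto_setIntegral_abs_sub (hφu i R))
    rw [add_zero] at h1
    refine squeeze_zero' (Eventually.of_forall fun k => integral_nonneg fun x => abs_nonneg _) ?_ h1
    filter_upwards [hle (tendsto_natCast_atTop_atTop.eventually_ge_atTop R)] with k hk
    have i1 : LocallyIntegrable (u k i) := ((hap k).weak i).left
    have i2 : LocallyIntegrable (U k i) := ((hap k).smooth i).continuous.locallyIntegrable
    have i3 : LocallyIntegrable (φ i) := (hφc i).locallyIntegrable
    have hcb := isCompact_closedBall (0 : Rn n) R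
    have j1 := ((i1.sub i2).integrableOn_isCompact hcb).abs
    have j2 := ((i2.sub i3).integrableOn_isCompact hcb).abs
    have h2 : ∫ x in Metric.closedBall 0 R, |u k i x - U k i x| ≤ δ k := by
      refine le_trans ?_ ((hap k).close i)
      exact setIntegral_mono_set
        (((i1.sub i2).integrableOn_isCompact (isCompact_closedBall (0 : Rn n) (k : ℝ))).abs)
        (Eventually.of_forall fun x => abs_nonneg _)
        (Metric.closedBall_subset_closedBall hk).eventuallyLE
    calc ∫ x in Metric.closedBall 0 R, |u k i x - φ i x|
        ≤ ∫ x in Metric.closedBall 0 R, (|u k i x - U k i x| + |U k i x - φ i x|) :=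
          integral_mono ((i1.sub i3).integrableOn_isCompact hcb).abs (j1.add j2)
            fun x => abs_sub_le _ _ _
      _ = (∫ x in Metric.closedBall 0 R, |u k i x - U k i x|)
          + ∫ x in Metric.closedBall 0 R, |U k i x - φ i x| := integral_add j1 j2
      _ ≤ _ := add_le_add_left h2 _
  have hAφ : ∀ i, LocallyIntegrable (fun x => ∑ j, A x i j * φ j x) := fun i =>
    locallyIntegrable_of_bounded_on_balls
      (Finset.measurable_sum _ fun j _ => (hS.measurable i j).mul (hφc j).measurable) fun R => by
        have hb : ∀ j, ∃ M, ∀ x ∈ Metric.closedBall (0 : Rn n) R, ‖φ j x‖ ≤ M := fun j =>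
          (isCompact_closedBall (0 : Rn n) R).exists_bound_of_continuousOn (hφc j).continuousOn
        choose M hM using hb
        refine ⟨∑ j, B * M j, fun x hx => (Finset.abs_sum_le_sum_abs _ _).trans
          (Finset.sum_le_sum fun j _ => ?_)⟩
        rw [abs_mul]
        exact mul_le_mul (hS.bound x i j) (hM j x (by simpa using hx)) (abs_nonneg _) hB0
  refine ⟨φ, hφc, fun i x => ge_of_tendsto' (hφ i x) fun k => (hap k).nonneg i x, ?_, fun i =>
    ⟨(hφc i).locallyIntegrable, hAφ i, fun η hη => ?_⟩⟩
  · have h1 := tendsto_finsetSum Finset.univ fun i (_ : i ∈ Finset.univ) => hφ i 0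
    refine tendsto_nhds_unique h1 (tendsto_const_nhds.congr fun k => ?_)
    exact (hap k).normalised.symm
  · obtain ⟨R, hR, hz⟩ := hη.exists_radius
    obtain ⟨Cη, hCη, hbη⟩ := hη.exists_bound
    obtain ⟨C', R', hb', hz'⟩ := hK.exists_bound_support hη
    have hηm := hη.continuous.measurable
    have iu : ∀ k j, LocallyIntegrable (u k j) := fun k j => ((hap k).weak j).left
    have iφ : ∀ j, LocallyIntegrable (φ j) := fun j => (hφc j).locallyIntegrable
    have t1 : Tendsto (fun k => ∫ x, u k i x * nonlocalOp K η x) l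
        (𝓝 (∫ x, φ i x * nonlocalOp K η x)) :=
      tendsto_integral_mul (fun k => iu k i) (iφ i) (hL1 i)
        (hK.measurable_nonlocalOp hη.continuous) hb' hz'
    have hAb : ∀ j x, |A x i j * η x| ≤ B * Cη := fun j x => by
      rw [abs_mul]; exact mul_le_mul (hS.bound x i j) (hbη x) (abs_nonneg _) hB0
    have hAz : ∀ j x, R < ‖x‖ → A x i j * η x = 0 := fun j x hx => by rw [hz x hx, mul_zero]
    have hAm : ∀ j, Measurable fun x => A x i j * η x := fun j => (hS.measurable i j).mul hηm
    have t2 : ∀ j, Tendsto (fun k => ∫ x, u k j x * (A x i j * η x)) l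
        (𝓝 (∫ x, φ j x * (A x i j * η x))) := fun j =>
      tendsto_integral_mul (fun k => iu k j) (iφ j) (hL1 j) (hAm j) (hAb j) (hAz j)
    have t3 : Tendsto (fun k => ∫ x, u k i x * η x) l (𝓝 (∫ x, φ i x * η x)) :=
      tendsto_integral_mul (fun k => iu k i) (iφ i) (hL1 i) hηm hbη hz
    -- Once k ≥ 2R the support of η lies in the ball of radius k/2, where the source is at most δ.
    have t4 : Tendsto (fun k => ∫ x, s k x * η x) l (𝓝 0) := by
      have h1 := (hδ.mono_left hle).mul_const (∫ x, |η x|)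
      rw [zero_mul] at h1
      refine squeeze_zero_norm' ?_ h1
      filter_upwards [hle (tendsto_natCast_atTop_atTop.eventually_ge_atTop (2 * R))] with k hk
      rw [← integral_const_mul]
      refine norm_integral_le_of_norm_le
        ((hη.continuous.integrable_of_hasCompactSupport hη.2).abs.const_mul _)
        (Eventually.of_forall fun x => ?_)
      by_cases hx : ‖x‖ ≤ R
      · rw [norm_mul, Real.norm_of_nonneg ((hap k).source_nonneg x)]
        exact mul_le_mul_of_nonneg_right ((hap k).source_le x (by linarith)) (abs_nonneg _)
      · simp [hz x (not_le.1 hx)]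
    have t5 : Tendsto (fun k : ℕ => 1 / ((k : ℝ) + 1)) l (𝓝 0) :=
      tendsto_one_div_add_atTop_nhds_zero_nat.mono_left hle
    have t6 := ((tendsto_finsetSum Finset.univ fun j (_ : j ∈ Finset.univ) => t2 j).sub
      (t5.mul t3)).add t4
    have heq : ∀ k : ℕ, ∫ x, u k i x * nonlocalOp K η x
        = (∑ j, ∫ x, u k j x * (A x i j * η x)) - 1 / ((k : ℝ) + 1) * (∫ x, u k i x * η x)
          + ∫ x, s k x * η x := by
      intro k
      have j1 : ∀ j, Integrable (fun x => u k j x * (A x i j * η x)) := fun j =>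
        integrable_mul_of_bounded_support (iu k j) (hAm j) (hAb j) (hAz j)
      have j2 := integrable_mul_test (iu k i) hη
      have j3 := integrable_mul_test (hap k).source_continuous.locallyIntegrable hη
      have j4 : Integrable (fun x => ∑ j, u k j x * (A x i j * η x)) :=
        integrable_finsetSum _ fun j _ => j1 j
      have j5 : Integrable (fun x => (∑ j, u k j x * (A x i j * η x))
          - 1 / ((k : ℝ) + 1) * (u k i x * η x)) := j4.sub (j2.const_mul _)
      rw [((hap k).weak i).eq η hη, ← integral_finsetSum _ fun j _ => j1 j, ← integral_const_mul,
        ← integral_sub j4 (j2.const_mul _), ← integral_add j5 j3]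
      congr 1; ext x
      rw [add_mul, sub_mul, Finset.sum_mul]
      congr 1
      congr 1
      · exact Finset.sum_congr rfl fun j _ => by ring
      · ring
    simp only [← heq, zero_mul, sub_zero, add_zero] at t6
    rw [tendsto_nhds_unique t1 t6, ← integral_finsetSum _ fun j _ =>
      integrable_mul_of_bounded_support (iφ j) (hAm j) (hAb j) (hAz j)]
    congr 1; ext x
    rw [Finset.sum_mul]
    exact Finset.sum_congr rfl fun j _ => by ring

end Limit

/-! ### Positive solutions and the main theorem -/

section Main

variable {n m : ℕ} {K : Rn n → ℝ} {B : ℝ} {A : Rn n → Matrix (Fin m) (Fin m) ℝ}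

theorem exists_pos_solution [NeZero m] (hn : 0 < n) (hK : KernelCondition K)
    (hB : HarnackCondition K) (hC : HolderCondition K) (hS : IsStableCooperative K B A)
    (hB0 : 0 ≤ B) :
    ∃ φ : Fin m → Rn n → ℝ, (∀ i x, 0 < φ i x) ∧
      ∀ i, IsSolution K (φ i) (fun x => ∑ j, A x i j * φ j x) := by
  obtain ⟨φ, hφc, hφ0, hφ1, hφ⟩ := exists_nonneg_solution hn hK hB hC hS hB0
  -- The diagonal entry is bounded below by −B and all off-diagonal terms except the j-th are
  -- discarded. This gives both the supersolution property and the final contradiction.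
  have hlow : ∀ i j x, i ≠ j →
      -(B * φ i x) + A x i j * φ j x ≤ ∑ l, A x i l * φ l x := by
    intro i j x hij
    have h1 : -(B * φ i x) ≤ A x i i * φ i x := by
      rw [← neg_mul]
      exact mul_le_mul_of_nonneg_right (abs_le.1 (hS.bound x i i)).1 (hφ0 i x)
    have h2 : A x i j * φ j x ≤ ∑ l ∈ Finset.univ.erase i, A x i l * φ l x :=
      Finset.single_le_sum (f := fun l => A x i l * φ l x) (fun l hl =>
        mul_nonneg (hS.pos x i l (Finset.ne_of_mem_erase hl).symm).le (hφ0 l x))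
        (Finset.mem_erase.2 ⟨hij.symm, Finset.mem_univ j⟩)
    rw [← Finset.add_sum_erase _ _ (Finset.mem_univ i)]
    linarith
  have hsuper : ∀ i x, -(B * φ i x) ≤ ∑ l, A x i l * φ l x := by
    intro i x
    by_cases hex : ∃ j, i ≠ j
    · obtain ⟨j, hij⟩ := hex
      linarith [hlow i j x hij, mul_nonneg (hS.pos x i j hij).le (hφ0 j x)]
    · have hex' : ∀ j, j = i := fun j => by
        by_contra hne
        exact hex ⟨j, fun h => hne h.symm⟩
      rw [Finset.sum_eq_single i (fun j _ hj => absurd (hex' j) hj) (by simp), ← neg_mul]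
      exact mul_le_mul_of_nonneg_right (abs_le.1 (hS.bound x i i)).1 (hφ0 i x)
  have hdich : ∀ i x y, φ i x = 0 → φ i y = 0 := fun i x y hx =>
    (hφ i).eq_zero_of_exists_zero hK (hB.volume_ne_zero hn) hB0 (hφc i) (hφ0 i) (hsuper i) hx y
  obtain ⟨j, hj⟩ : ∃ j, φ j 0 ≠ 0 := by
    by_contra! hall
    simp [hall] at hφ1
  have hjpos : ∀ x, 0 < φ j x := fun x =>
    (hφ0 j x).lt_of_ne' fun hx => hj (hdich j x 0 hx)
  refine ⟨φ, fun i x => (hφ0 i x).lt_of_ne' fun hx => ?_, fun i =>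
    ⟨hφc i, (hφ i).right, (hφ i).eq⟩⟩
  have hzero : ∀ y, φ i y = 0 := fun y => hdich i x y hx
  have hij : i ≠ j := by
    rintro rfl
    exact hj (hzero 0)
  -- If component i vanishes identically, its weak equation says that the right-hand side is zero as
  -- a distribution, although it contains the positive term A_ij φ_j.
  have hae : ∀ᵐ y, ∑ l, A y i l * φ l y = 0 := by
    refine ae_eq_zero_of_integral_contDiff_smul_eq_zero (hφ i).right fun g hg hgs => ?_
    have h1 := (hφ i).eq g ⟨hg, hgs⟩
    simp only [hzero, zero_mul, integral_zero] at h1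
    simp only [smul_eq_mul, mul_comm (g _)]
    exact h1.symm
  obtain ⟨y, hy⟩ := hae.exists
  have h1 := hlow i j y hij
  have h2 := mul_pos (hS.pos y i j hij) (hjpos y)
  rw [hy, hzero y, mul_zero, neg_zero, zero_add] at h1
  linarith

/-- The partial derivatives along u need not be continuous; a line derivative of a continuous
function is still measurable as a function of the base point. -/
theorem measurable_linearization {H : Fin m → (Fin m → ℝ) → ℝ} (hH : ∀ i, Continuous (H i))
    {u : Fin m → Rn n → ℝ} (hu : ∀ i, Continuous (u i)) (i j : Fin m) :
    Measurable fun x => linearization H u x i j := by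
  have h1 : Measurable (valueAt u) := (continuous_pi hu).measurable
  exact (measurable_lineDeriv (𝕜 := ℝ) (v := Pi.single j 1) (hH i)).comp h1

/-- After a change of signs, an orientable symmetric system is cooperative. -/
theorem isStableCooperative_of_orientation (hK : KernelCondition K)
    {H : Fin m → (Fin m → ℝ) → ℝ} (hH : ∀ i, Continuous (H i))
    {u : Fin m → Rn n → ℝ} (hu : ∀ i, Continuous (u i))
    (hbdd : ∀ i j x, |linearization H u x i j| ≤ B)
    (hsymm : IsSymmetricSystem H u) {θ : Fin m → ℝ} (hθ : ∀ i, θ i = -1 ∨ θ i = 1)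
    (hpos : ∀ i j, i < j → ∀ x, 0 < linearization H u x i j * θ i * θ j)
    (hstab : StabilityInequality K H u) :
    IsStableCooperative K B
      (fun x => Matrix.of fun i j => linearization H u x i j * θ i * θ j) where
  measurable i j := ((measurable_linearization hH hu i j).mul_const _).mul_const _
  bound x i j := by
    have h1 : ∀ i, |θ i| = 1 := fun i => by rcases hθ i with h | h <;> simp [h]
    simp only [Matrix.of_apply, abs_mul, h1, mul_one]
    exact hbdd i j x
  symm x i j := by
    simp only [Matrix.of_apply, (hsymm x).apply j i]
    ring
  pos x i j hij := by
    rcases lt_or_gt_of_ne hij with h | h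
    · exact hpos i j h x
    · have := hpos j i h x
      simp only [Matrix.of_apply, (hsymm x).apply j i]
      linarith
  stable ζ hζ := by
    have hsq : ∀ i, θ i ^ 2 = 1 := fun i => by rcases hθ i with h | h <;> simp [h]
    -- Inserting θ_iζ_i puts the signs onto the matrix and leaves the energies unchanged because
    -- θ_i² = 1.
    have h := hstab (fun i x => θ i * ζ i x) fun i =>
      ⟨contDiff_const.mul (hζ i).1, (hζ i).2.mul_left⟩
    have e1 : ∀ i, (∫ x, ∫ z, (θ i * ζ i x - θ i * ζ i z) ^ 2 * K (z - x))
        = 2 * ∫ x, ζ i x * nonlocalOp K (ζ i) x := by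
      intro i
      simp only [← mul_sub, mul_pow, hsq, one_mul]
      rw [hK.iterated_energy (hζ i), ← hK.energy_eq (hζ i)]
      ring
    simp only [e1, ← Finset.mul_sum] at h
    calc _ = ∑ i, ∑ j, ∫ x, linearization H u x i j * (θ i * ζ i x) * (θ j * ζ j x) := by
          refine Finset.sum_congr rfl fun i _ => Finset.sum_congr rfl fun j _ => ?_
          congr 1; ext x
          simp only [Matrix.of_apply]; ring
      _ ≤ _ := by linarith

end Main

theorem mainTheorem3 (n m : ℕ) (hn : 0 < n)
    (K : Rn n → ℝ) (hA : KernelCondition K) (hB : HarnackCondition K) (hC : HolderCondition K)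
    (H : Fin m → (Fin m → ℝ) → ℝ) (hH : ∀ i, LocallyLipschitz (H i))
    (u : Fin m → Rn n → ℝ) (hu : IsSystemSolution K H u)
    (hdiff : ∀ i j x, LineDifferentiableAt ℝ (H i) (valueAt u x) (Pi.single j 1))
    (hbdd : ∃ B : ℝ, ∀ i j x, |linearization H u x i j| ≤ B)
    (hsymm : IsSymmetricSystem H u) (horient : IsOrientableSystem H u)
    (hstab : StabilityInequality K H u) :
    IsStableSolution K H u := by
  refine ⟨hu, ?_⟩
  -- The empty system is separate: the construction normalises a sum of components to 1.
  rcases Nat.eq_zero_or_pos m with rfl | hm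
  · exact ⟨fun i => i.elim0, 0, le_rfl, fun i => i.elim0, fun i => i.elim0, fun i => i.elim0⟩
  have : NeZero m := ⟨hm.ne'⟩
  obtain ⟨B, hBd⟩ := hbdd
  obtain ⟨θ, hθ, hpos⟩ := horient
  have hB0 : 0 ≤ B := (abs_nonneg _).trans (hBd 0 0 0)
  have hS := isStableCooperative_of_orientation hA (fun i => (hH i).continuous)
    (fun i => (hu i).1) hBd hsymm hθ hpos hstab
  obtain ⟨φ, hφ0, hφ⟩ := exists_pos_solution hn hA hB hC hS hB0
  have hsq : ∀ i, θ i * θ i = 1 := fun i => by rcases hθ i with h | h <;> simp [h]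
  -- Restoring the signs undoes the change of unknowns; the resolvent parameter has already tended
  -- to 0, so λ = 0.
  refine ⟨fun i x => θ i * φ i x, 0, le_rfl, fun i => ?_, fun i => ?_, fun i j hij x => ?_⟩
  · rcases hθ i with h | h
    · exact Or.inr fun x => by simp only [h]; linarith [hφ0 i x]
    · exact Or.inl fun x => by simp only [h]; linarith [hφ0 i x]
  · have h := (hφ i).isWeakSolution.const_mul (θ i)
    have e : (fun x => ∑ j, linearization H u x i j * (θ j * φ j x) + 0 * (θ i * φ i x))
        = fun x => θ i * ∑ j, Matrix.of (fun i j => linearization H u x i j * θ i * θ j) i j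
          * φ j x := by
      ext x
      rw [zero_mul, add_zero, Finset.mul_sum]
      refine Finset.sum_congr rfl fun j _ => ?_
      simp only [Matrix.of_apply]
      linear_combination (-(linearization H u x i j * θ j * φ j x)) * hsq i
    rw [e]
    exact ⟨(hφ i).1.const_mul (θ i), h.right, h.eq⟩
  · have h := mul_pos (mul_pos (hpos i j hij x) (hφ0 i x)) (hφ0 j x)
    calc 0 < _ := h
      _ = _ := by ring
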